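/- Let $k \ge 2$, let $F_k$ be the free group on generators $A_1,\dots,A_k$, and let $\Phi = (\log_1,\dots,\log_k) : F_k \to \mathbb{Z}^k$ be the homomorphism determined by $\log_j(A_i) = \delta_{ij}$; it is constant on conjugacy classes. The length of a conjugacy class of $F_k$ is the minimal word length (with respect to $A_1^{\pm1},\dots,A_k^{\pm1}$) of its elements. For $B \subseteq \mathbb{Z}^k$ and an integer $m \ge 0$, let $\Pi_B(m)$ be the number of conjugacy classes $c$ of $F_k$ of length at most $m$ with $\Phi(c) \in B$, and let $\Pi(m)$ be the number of all conjugacy classes of $F_k$ of length at most $m$. Suppose that $B$ has asymptotic density $d(B)$ with respect to the Euclidean norm $\|\cdot\|$, i.e. $$\frac{\#\{\beta \in B : \|\beta\| \le r\}}{\#\{\beta \in \mathbb{Z}^k : \|\beta\| \le r\}} \longrightarrow d(B) \qquad (r \to \infty).$$ Then $$\frac12\left(\frac{\Pi_B(m)}{\Pi(m)} + \frac{\Pi_B(m+1)}{\Pi(m+1)}\right) \longrightarrow d(B) \qquad (m \to \infty).$$ -/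

import Mathlib

open Filter Topology

noncomputable section

/-- The discrete logarithm `log_j : F_k → ℤ`: the homomorphism with `log_j (A_i) = δ_{ij}`. -/
def discreteLog {k : ℕ} (j : Fin k) : FreeGroup (Fin k) →* Multiplicative ℤ :=
  FreeGroup.lift fun i => Multiplicative.ofAdd (if i = j then (1 : ℤ) else 0)

/-- The vector `Φ(γ) = (log_1 γ, …, log_k γ) ∈ ℤ^k` of discrete logarithms. -/
def logVector {k : ℕ} (γ : FreeGroup (Fin k)) : Fin k → ℤ :=
  fun j => Multiplicative.toAdd (discreteLog j γ)

theorem logVector_eq_of_isConj {k : ℕ} {γ γ' : FreeGroup (Fin k)} (h : IsConj γ γ') :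
    logVector γ = logVector γ' := by
  funext j
  unfold logVector
  rw [isConj_iff_eq.mp ((discreteLog j).map_isConj h)]

/-- `Φ` on conjugacy classes. -/
def classLogVector {k : ℕ} (c : ConjClasses (FreeGroup (Fin k))) : Fin k → ℤ :=
  Quotient.lift logVector (fun _ _ h => logVector_eq_of_isConj h) c

/-- The length of a conjugacy class: the minimal word length (`FreeGroup.norm` is the length of
the reduced word) of its elements. -/
def classLength {k : ℕ} (c : ConjClasses (FreeGroup (Fin k))) : ℕ :=
  sInf (FreeGroup.norm '' c.carrier)

/-- `Π_B(m)`: the number of conjugacy classes `c` of length at most `m` with `Φ(c) ∈ B`. -/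
def classCountIn {k : ℕ} (B : Set (Fin k → ℤ)) (m : ℕ) : ℕ :=
  {c : ConjClasses (FreeGroup (Fin k)) | classLength c ≤ m ∧ classLogVector c ∈ B}.ncard

/-- `Π(m)`: the number of conjugacy classes of length at most `m` in the free group `F_k`. -/
def classCount (k m : ℕ) : ℕ :=
  {c : ConjClasses (FreeGroup (Fin k)) | classLength c ≤ m}.ncard

/-- The standard Euclidean norm on `ℤ^k ⊆ ℝ^k`. -/
def latticeNorm {k : ℕ} (β : Fin k → ℤ) : ℝ :=
  ‖(WithLp.toLp 2 (fun i => (β i : ℝ)) : EuclideanSpace ℝ (Fin k))‖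

/-- `B ⊆ ℤ^k` has asymptotic density `d` with respect to the Euclidean norm. -/
def HasAsymptoticDensity {k : ℕ} (B : Set (Fin k → ℤ)) (d : ℝ) : Prop :=
  Tendsto
    (fun r : ℝ => ({β : Fin k → ℤ | β ∈ B ∧ latticeNorm β ≤ r}.ncard : ℝ) /
      ({β : Fin k → ℤ | latticeNorm β ≤ r}.ncard : ℝ))
    atTop (𝓝 d)

end

/-!
Every conjugacy class of `F_k` contains cyclically reduced words, they have minimal length in the
class, and they form a single orbit under rotation (`isRotated_of_mk_conj_eq`). An orbit of words of
length `n` has `n` elements unless the word is periodic, which is exponentially rare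
(`ncard_classesOfLength_bounds`). The problem is thereby reduced to the distribution of `Φ` on
cyclically reduced words.

Give the letters `A_j ^ (± 1)` the weights `exp (± i θ_j)`. The sum over the cyclically reduced
words of length `n` of the products of the weights is the trace of the `n`-th power of the transfer
matrix of reduced words, and this trace is explicit (`trace_transferMatrix_pow_eq`): apart from
`± 1`, the eigenvalues are the roots of `λ ^ 2 - 2 s λ + q`, where `s = ∑ cos θ_j` and `q = 2k - 1`.
Divided by `q ^ n`, the trace thus is a function of `s` with one peak at `θ = 0` and, since the
eigenvalues for `-s` are minus those for `s`, another one at `θ = (π, …, π)` that carries the sign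
`(-1) ^ n`. The second peak reflects that the parity of `∑ β_j` is that of the length; averaging
over the lengths `n` and `n + 1` removes it (`norm_charFn_add_succ_le`). Fourier inversion then
gives a local limit theorem (`abs_meanDensity_sub_le`, `tendsto_charFnError`): up to
`o(n ^ (-k / 2))`, uniformly in `β`, the proportion of words with image `β`, averaged over the
two lengths, is the Gaussian `√t ^ k * exp (-π t ‖β‖ ^ 2)` with `t = (k - 1) / (2 π n)`.

This Gaussian is a mixture of the indicators of balls centred at the origin, so that by an Abelian
argument it gives to a set of asymptotic density `d` a mass that tends to `d`
(`tendsto_tsum_indicator_gaussianWeight`). The local limit theorem, applied on balls of radius a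
large multiple of `√n`, bounds the mass of a set below by its Gaussian mass; as the total masses
agree, the same bound for the complement turns this into an equality in the limit
(`tendsto_meanMass`).
Finally, the counts of classes of length at most `m` satisfy a contracting affine recursion
(`mul_countRatio_succ`), by which the limit passes from length `n` to length at most `m`.
-/

/-! ### Cyclically reduced words and conjugacy classes -/

namespace FreeGroup

variable {α : Type*}

theorem IsReduced.invRev {L : List (α × Bool)} (h : IsReduced L) :
    IsReduced (FreeGroup.invRev L) := by
  classical
  rw [isReduced_iff_reduce_eq] at h ⊢
  rw [reduce_invRev, h]

theorem IsReduced.eq_of_mk_eq {L L' : List (α × Bool)} (h : IsReduced L) (h' : IsReduced L')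
    (he : mk L = mk L') : L = L' := by
  classical
  rw [← h.reduce_eq, ← h'.reduce_eq]
  exact reduce.sound he

theorem mk_cons (y : α × Bool) (T : List (α × Bool)) : mk (y :: T) = mk [y] * mk T := by
  rw [mul_mk, List.singleton_append]

theorem IsCyclicallyReduced.rotate_one {y : α × Bool} {T : List (α × Bool)} :
    IsCyclicallyReduced (y :: T) ↔ IsCyclicallyReduced (T ++ [y]) := by
  rcases eq_or_ne T [] with rfl | hT
  · simp
  · have h1 : (y :: T).getLast? = T.getLast? := by
      rw [← List.singleton_append, List.getLast?_append_of_ne_nil _ hT]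
    have h2 : (T ++ [y]).head? = T.head? := List.head?_append_of_ne_nil _ hT
    simp only [IsCyclicallyReduced, IsReduced, List.isChain_cons, List.isChain_append, h1, h2,
      List.getLast?_concat, List.head?_cons, List.isChain_nil, Option.mem_some_iff, forall_eq',
      List.head?_nil, Option.not_mem_none, false_imp_iff, implies_true, true_and]
    tauto

theorem IsCyclicallyReduced.rotate {L : List (α × Bool)} (h : IsCyclicallyReduced L) (n : ℕ) :
    IsCyclicallyReduced (L.rotate n) := by
  induction n with
  | zero => simpa
  | succ n ih =>
    rw [← List.rotate_rotate]
    generalize L.rotate n = L' at ih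
    rcases L' with _ | ⟨y, T⟩
    · simp
    · simpa using IsCyclicallyReduced.rotate_one.1 ih

theorem isConj_mk_rotate (L : List (α × Bool)) (n : ℕ) : IsConj (mk L) (mk (L.rotate n)) := by
  induction n with
  | zero => rw [List.rotate_zero]
  | succ n ih =>
    refine ih.trans ?_
    rw [← List.rotate_rotate]
    rcases L.rotate n with _ | ⟨y, T⟩
    · rw [List.rotate_nil]
    · rw [isConj_iff]
      refine ⟨(mk [y])⁻¹, ?_⟩
      rw [show (y :: T).rotate 1 = T ++ [y] by simp, ← mul_mk, mk_cons y T]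
      group

/-- Cyclically reduced words that are conjugate by a reduced word `G` are rotations of each other.
By induction on `G`: if its last letter `x` cancels against the beginning or the end of `L`, then
conjugating by `x` rotates `L` by one letter; if it does not, `G L G⁻¹` is reduced as it stands and
fails to be cyclically reduced. -/
theorem isRotated_of_mk_conj_eq (G : List (α × Bool)) :
    ∀ {L L' : List (α × Bool)}, IsReduced G → IsCyclicallyReduced L → IsCyclicallyReduced L' →
      mk G * mk L * (mk G)⁻¹ = mk L' → L ~r L' := by
  induction G using List.reverseRecOn with
  | nil =>
    intro L L' _ hL hL' h
    simp only [← one_eq_mk, one_mul, inv_one, mul_one] at h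
    rw [hL.isReduced.eq_of_mk_eq hL'.isReduced h]
  | append_singleton G x ih =>
    intro L L' hG hL hL' h
    have hG' : IsReduced G := hG.infix ⟨[], [x], by simp⟩
    by_cases h1 : L.head? = some (x.1, !x.2)
    · obtain ⟨T, rfl⟩ : ∃ T, L = (x.1, !x.2) :: T := by
        rcases L with _ | ⟨y, T⟩
        · simp at h1
        · simp at h1; exact ⟨T, by rw [h1]⟩
      refine List.IsRotated.cons_append_singleton.trans
        (ih hG' (IsCyclicallyReduced.rotate_one.1 hL) hL' ?_)
      rw [← h]
      have : mk [(x.1, !x.2)] = (mk [x])⁻¹ := by simp [inv_mk, invRev]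
      rw [← mul_mk, ← mul_mk, mk_cons _ T, this]
      group
    by_cases h2 : L.getLast? = some x
    · obtain ⟨T, rfl⟩ : ∃ T, L = T ++ [x] := by
        rcases L.eq_nil_or_concat with rfl | ⟨T, z, rfl⟩
        · simp at h2
        · simp at h2; exact ⟨T, by simp [h2]⟩
      refine List.IsRotated.cons_append_singleton.symm.trans
        (ih hG' (IsCyclicallyReduced.rotate_one.2 hL) hL' ?_)
      rw [← h]
      rw [mk_cons x T, ← mul_mk, ← mul_mk]
      group
    -- No cancellation takes place in `G x L x⁻¹ G⁻¹`, so this word is `L'` itself unless `L` is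
    -- empty; but its first and last letters are inverse to each other.
    by_cases h0 : L = []
    · subst h0
      simp only [← one_eq_mk, mul_one, mul_inv_cancel] at h
      rw [hL.isReduced.eq_of_mk_eq hL'.isReduced (by simpa [← one_eq_mk] using h)]
    exfalso
    obtain ⟨a, l, hx⟩ : ∃ a l, G ++ [x] = a :: l := by
      rcases G with _ | ⟨a, l⟩
      · exact ⟨_, _, rfl⟩
      · exact ⟨_, _, rfl⟩
    have hred : IsReduced (G ++ [x] ++ L ++ invRev (G ++ [x])) := by
      refine List.isChain_append.2 ⟨List.isChain_append.2 ⟨hG, hL.isReduced, ?_⟩, hG.invRev, ?_⟩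
      · intro u hu v hv huv
        simp at hu
        subst hu
        by_contra hne
        apply h1
        rw [hv]
        congr 1
        ext <;> simp [huv]
        revert hne
        cases x.2 <;> cases v.2 <;> simp
      · intro u hu v hv huv
        rw [List.getLast?_append_of_ne_nil _ h0] at hu
        simp [invRev_append] at hv
        simp [invRev] at hv
        subst hv
        by_contra hne
        apply h2
        rw [hu]
        congr 1
        ext
        · simpa using huv
        · revert hne
          simp
    have heq : G ++ [x] ++ L ++ invRev (G ++ [x]) = L' := by
      refine hred.eq_of_mk_eq hL'.isReduced ?_
      rw [← h, inv_mk, mul_mk, mul_mk]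
    have h3 := hL'.2
    rw [← heq, hx] at h3
    have := h3 (a.1, !a.2) (by
      rw [List.getLast?_append_of_ne_nil _ (by simp [invRev])]
      simp [invRev]) a (by simp) rfl
    simp at this

theorem IsCyclicallyReduced.isConj_iff_isRotated {L L' : List (α × Bool)}
    (hL : IsCyclicallyReduced L) (hL' : IsCyclicallyReduced L') :
    IsConj (mk L) (mk L') ↔ L ~r L' := by
  classical
  constructor
  · intro h
    obtain ⟨c, hc⟩ := isConj_iff.1 h
    refine isRotated_of_mk_conj_eq c.toWord isReduced_toWord hL hL' ?_
    rwa [mk_toWord]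
  · rintro ⟨n, rfl⟩
    exact isConj_mk_rotate L n

theorem exists_isCyclicallyReduced_isConj [DecidableEq α] (g : FreeGroup α) :
    ∃ L, IsCyclicallyReduced L ∧ IsConj (mk L) g ∧ L.length ≤ g.norm := by
  refine ⟨reduceCyclically g.toWord, reduceCyclically.isCyclicallyReduced isReduced_toWord, ?_, ?_⟩
  · rw [isConj_iff]
    refine ⟨mk (reduceCyclically.conjugator g.toWord), ?_⟩
    rw [inv_mk, mul_mk, mul_mk, reduceCyclically.conj_conjugator_reduceCyclically, mk_toWord]
  · have := congrArg List.length (reduceCyclically.conj_conjugator_reduceCyclically g.toWord)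
    simp only [List.length_append] at this
    unfold norm
    omega

end FreeGroup

section CyclicWords

open FreeGroup

variable {k : ℕ}

/-- A cyclically reduced word has minimal length in its conjugacy class. -/
theorem classLength_mk {L : List (Fin k × Bool)} (hL : IsCyclicallyReduced L) :
    classLength (ConjClasses.mk (FreeGroup.mk L)) = L.length := by
  unfold classLength
  apply le_antisymm
  · refine Nat.sInf_le ⟨FreeGroup.mk L, ConjClasses.mem_carrier_mk, ?_⟩
    rw [FreeGroup.norm, toWord_mk, hL.isReduced.reduce_eq]
  · refine le_csInf ⟨_, FreeGroup.mk L, ConjClasses.mem_carrier_mk, rfl⟩ ?_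
    rintro _ ⟨g, hg, rfl⟩
    obtain ⟨L', hL', hc, hle⟩ := exists_isCyclicallyReduced_isConj g
    have hc' : IsConj g (FreeGroup.mk L) := by
      rwa [ConjClasses.mem_carrier_iff_mk_eq, ConjClasses.mk_eq_mk_iff_isConj] at hg
    rw [← ((hL'.isConj_iff_isRotated hL).1 (hc.trans hc')).perm.length_eq]
    exact hle

theorem exists_isCyclicallyReduced_mk_eq (c : ConjClasses (FreeGroup (Fin k))) :
    ∃ L : List (Fin k × Bool), IsCyclicallyReduced L ∧ ConjClasses.mk (FreeGroup.mk L) = c := by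
  obtain ⟨g, rfl⟩ := ConjClasses.mk_surjective c
  obtain ⟨L, hL, hc, -⟩ := exists_isCyclicallyReduced_isConj g
  exact ⟨L, hL, ConjClasses.mk_eq_mk_iff_isConj.2 hc⟩

/-- The cyclically reduced words of length `n` whose image in `ℤ^k` lies in `B`. -/
def cyclicWords (B : Set (Fin k → ℤ)) (n : ℕ) : Set (List (Fin k × Bool)) :=
  {L | IsCyclicallyReduced L ∧ L.length = n ∧ logVector (FreeGroup.mk L) ∈ B}

/-- The conjugacy classes of length exactly `n` whose image in `ℤ^k` lies in `B`. -/
def classesOfLength (B : Set (Fin k → ℤ)) (n : ℕ) : Set (ConjClasses (FreeGroup (Fin k))) :=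
  {c | classLength c = n ∧ classLogVector c ∈ B}

theorem cyclicWords_finite (B : Set (Fin k → ℤ)) (n : ℕ) : (cyclicWords B n).Finite :=
  (List.finite_length_eq (Fin k × Bool) n).subset fun _ h => h.2.1

theorem mk_image_cyclicWords (B : Set (Fin k → ℤ)) (n : ℕ) :
    (fun L => ConjClasses.mk (FreeGroup.mk L)) '' cyclicWords B n = classesOfLength B n := by
  ext c
  constructor
  · rintro ⟨L, ⟨hL, hn, hB⟩, rfl⟩
    exact ⟨(classLength_mk hL).trans hn, hB⟩
  · rintro ⟨hn, hB⟩
    obtain ⟨L, hL, rfl⟩ := exists_isCyclicallyReduced_mk_eq c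
    exact ⟨L, ⟨hL, (classLength_mk hL).symm.trans hn, hB⟩, rfl⟩

theorem classesOfLength_finite (B : Set (Fin k → ℤ)) (n : ℕ) : (classesOfLength B n).Finite := by
  rw [← mk_image_cyclicWords]
  exact (cyclicWords_finite B n).image _

theorem fiber_cyclicWords {B : Set (Fin k → ℤ)} {n : ℕ} {L : List (Fin k × Bool)}
    (hL : L ∈ cyclicWords B n) :
    {L' ∈ cyclicWords B n | ConjClasses.mk (FreeGroup.mk L') = ConjClasses.mk (FreeGroup.mk L)} =
      {L' | L' ~r L} := by
  ext L'
  simp only [Set.mem_ofPred_eq, ConjClasses.mk_eq_mk_iff_isConj]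
  constructor
  · rintro ⟨h1, h2⟩
    exact (h1.1.isConj_iff_isRotated hL.1).1 h2
  · intro h
    obtain ⟨m, rfl⟩ := h.symm
    have hc := (isConj_mk_rotate L m).symm
    refine ⟨⟨hL.1.rotate m, by simp [hL.2.1], ?_⟩, hc⟩
    rw [logVector_eq_of_isConj hc]
    exact hL.2.2

theorem ncard_isRotated_le {α : Type*} {L : List α} (h : L ≠ []) :
    {L' | L' ~r L}.ncard ≤ L.length := by
  classical
  have : {L' | L' ~r L} = (L.cyclicPermutations.toFinset : Set (List α)) := by
    ext L'
    simp
  rw [this, Set.ncard_coe_finset]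
  exact (List.toFinset_card_le _).trans (List.length_cyclicPermutations_of_ne_nil L h).le

/-- A word with fewer than `L.length` distinct rotations has a period at most half its length. -/
theorem exists_rotate_eq_self_of_ncard_lt {α : Type*} {L : List α}
    (h : {L' | L' ~r L}.ncard < L.length) :
    ∃ p, 0 < p ∧ p ≤ L.length / 2 ∧ L.rotate p = L := by
  classical
  have hne : L ≠ [] := by rintro rfl; simp at h
  have hper : ∃ p, 0 < p ∧ p < L.length ∧ L.rotate p = L := by
    by_contra! hcon
    have hinj : Set.InjOn (fun i => L.rotate i) (Finset.range L.length : Set ℕ) := by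
      have key : ∀ i j : ℕ, i < j → j < L.length → L.rotate i ≠ L.rotate j := by
        intro i j hij hj heq
        apply hcon (j - i) (by omega) (by omega)
        apply List.rotate_injective i
        simp only [List.rotate_rotate]
        rw [heq]
        congr 1
        omega
      intro i hi j hj heq
      simp at hi hj
      rcases lt_trichotomy i j with hlt | heq' | hlt
      · exact absurd heq (key i j hlt hj)
      · exact heq'
      · exact absurd heq.symm (key j i hlt hi)
    have hsub : ((Finset.range L.length).image fun i => L.rotate i : Finset (List α)) ⊆
        L.cyclicPermutations.toFinset := by
      intro L' hL'
      simp only [Finset.mem_image] at hL'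
      obtain ⟨i, -, rfl⟩ := hL'
      simp only [List.mem_toFinset, List.mem_cyclicPermutations_iff]
      exact (List.IsRotated.forall L i)
    have h1 := Finset.card_le_card hsub
    rw [Finset.card_image_of_injOn hinj, Finset.card_range] at h1
    have h2 : {L' | L' ~r L} = (L.cyclicPermutations.toFinset : Set (List α)) := by
      ext L'
      simp
    rw [h2, Set.ncard_coe_finset] at h
    omega
  obtain ⟨p, hp0, hp, hrot⟩ := hper
  by_cases hle : p ≤ L.length / 2
  · exact ⟨p, hp0, hle, hrot⟩
  · refine ⟨L.length - p, by omega, by omega, ?_⟩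
    apply List.rotate_injective p
    simp only [List.rotate_rotate]
    rw [show L.length - p + p = L.length by omega, List.rotate_length, hrot]

/-- A word with period `p` is determined by its first `p` letters. -/
theorem eq_of_rotate_eq_self {α : Type*} {L L' : List α} {p : ℕ} (hp : 0 < p)
    (hlen : L.length = L'.length) (h : L.rotate p = L)
    (h' : L'.rotate p = L') (ht : L.take p = L'.take p) : L = L' := by
  have step : ∀ M : List α, M.rotate p = M → ∀ i : ℕ, p ≤ i → i < M.length → M[i]? = M[i - p]? := by
    intro M hM i hi hiM
    have h1 := List.getElem?_rotate (n := p) (show i - p < M.length by omega)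
    rw [hM, Nat.sub_add_cancel hi, Nat.mod_eq_of_lt hiM] at h1
    exact h1.symm
  have key : ∀ i : ℕ, L[i]? = L'[i]? := by
    intro i
    induction i using Nat.strong_induction_on with
    | _ i ih =>
      by_cases hi : i < p
      · rw [← List.getElem?_take_of_lt hi, ht, List.getElem?_take_of_lt hi]
      · by_cases hiL : i < L.length
        · rw [step L h i (by omega) hiL, step L' h' i (by omega) (by omega), ih _ (by omega)]
        · rw [List.getElem?_eq_none (by omega), List.getElem?_eq_none (by omega)]
  exact List.ext_getElem? key

theorem ncard_rotate_eq_self_le {α : Type*} [Fintype α] {n p : ℕ} (hp : 0 < p) (hpn : p ≤ n) :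
    {L : List α | L.length = n ∧ L.rotate p = L}.ncard ≤ Fintype.card α ^ p := by
  have hfin : {L : List α | L.length = p}.Finite := List.finite_length_eq α p
  have h1 : {L : List α | L.length = p}.ncard = Fintype.card α ^ p := by
    rw [← Nat.card_coe_set_eq]
    have : Nat.card (List.Vector α p) = Fintype.card α ^ p := by
      rw [Nat.card_eq_fintype_card, card_vector]
    exact this
  rw [← h1]
  refine Set.ncard_le_ncard_of_injOn (fun L => L.take p) ?_ ?_ hfin
  · rintro L ⟨hL, -⟩
    simp [hL, hpn]
  · rintro L ⟨hL, hr⟩ L' ⟨hL', hr'⟩ ht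
    exact eq_of_rotate_eq_self hp (hL.trans hL'.symm) hr hr' ht

/-- All but few conjugacy classes of length `n` consist of exactly `n` cyclically reduced words. -/
theorem ncard_classesOfLength_bounds (B : Set (Fin k → ℤ)) {n : ℕ} (hn : 0 < n) (hk : 0 < k) :
    (cyclicWords B n).ncard ≤ n * (classesOfLength B n).ncard ∧
    n * (classesOfLength B n).ncard ≤ (cyclicWords B n).ncard + n * (n * (2 * k) ^ (n / 2)) := by
  classical
  set W := (cyclicWords_finite B n).toFinset with hW
  set Q := (classesOfLength_finite B n).toFinset with hQ
  set f : List (Fin k × Bool) → ConjClasses (FreeGroup (Fin k)) :=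
    fun L => ConjClasses.mk (FreeGroup.mk L) with hf
  have hmem : ∀ L, L ∈ W ↔ L ∈ cyclicWords B n := by simp [hW]
  have himg : W.image f = Q := by
    apply Finset.coe_injective
    simp [hW, hQ, mk_image_cyclicWords, hf]
  have hcW : (cyclicWords B n).ncard = W.card := Set.ncard_eq_toFinset_card _ _
  have hcQ : (classesOfLength B n).ncard = Q.card := Set.ncard_eq_toFinset_card _ _
  have hfib : ∀ L ∈ W, (W.filter fun L' => f L' = f L).card = {L' | L' ~r L}.ncard := by
    intro L hL
    rw [← fiber_cyclicWords ((hmem L).1 hL), ← Set.ncard_coe_finset]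
    congr 1
    ext L'
    simp [hmem, hf]
  have hsum : W.card = ∑ c ∈ Q, (W.filter fun L' => f L' = c).card :=
    Finset.card_eq_sum_card_fiberwise fun L hL => by
      rw [← himg]
      exact Finset.mem_coe.2 (Finset.mem_image_of_mem f hL)
  have hlen : ∀ L ∈ W, L.length = n := fun L hL => ((hmem L).1 hL).2.1
  rw [hcW, hcQ]
  constructor
  · rw [hsum, mul_comm, ← smul_eq_mul]
    refine Finset.sum_le_card_nsmul _ _ _ ?_
    intro c hc
    rw [← himg, Finset.mem_image] at hc
    obtain ⟨L, hL, rfl⟩ := hc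
    rw [hfib L hL]
    have h1 := hlen L hL
    exact (ncard_isRotated_le (by rintro rfl; simp at h1; omega)).trans h1.le
  · -- the classes whose words have fewer than `n` rotations
    set bad := Q.filter fun c => (W.filter fun L' => f L' = c).card < n with hbad
    set badW := (Finset.Icc 1 (n / 2)).biUnion fun p => W.filter fun L => L.rotate p = L with hbadW
    have h1 : bad ⊆ badW.image f := by
      intro c hc
      rw [hbad, Finset.mem_filter, ← himg, Finset.mem_image] at hc
      obtain ⟨⟨L, hL, rfl⟩, hlt⟩ := hc
      rw [hfib L hL, ← hlen L hL] at hlt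
      obtain ⟨p, hp0, hp, hrot⟩ := exists_rotate_eq_self_of_ncard_lt hlt
      rw [hlen L hL] at hp
      refine Finset.mem_image_of_mem f ?_
      rw [hbadW, Finset.mem_biUnion]
      exact ⟨p, Finset.mem_Icc.2 ⟨hp0, hp⟩, Finset.mem_filter.2 ⟨hL, hrot⟩⟩
    have h2 : bad.card ≤ n * (2 * k) ^ (n / 2) := by
      refine (Finset.card_le_card h1).trans (Finset.card_image_le.trans ?_)
      refine Finset.card_biUnion_le.trans ?_
      have : ∀ p ∈ Finset.Icc 1 (n / 2), (W.filter fun L => L.rotate p = L).card ≤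
          (2 * k) ^ (n / 2) := by
        intro p hp
        rw [Finset.mem_Icc] at hp
        have h3 := ncard_rotate_eq_self_le (α := Fin k × Bool) (n := n) (p := p) (by omega)
          (by omega)
        rw [← Set.ncard_coe_finset]
        refine (Set.ncard_le_ncard ?_ ?_).trans (h3.trans ?_)
        · intro L hL
          simp only [Finset.coe_filter, Set.mem_ofPred_eq] at hL
          exact ⟨hlen L hL.1, hL.2⟩
        · exact (List.finite_length_eq _ n).subset fun L hL => hL.1
        · simp only [Fintype.card_prod, Fintype.card_fin, Fintype.card_bool]
          rw [mul_comm k 2]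
          exact Nat.pow_le_pow_right (by omega) hp.2
      refine (Finset.sum_le_card_nsmul _ _ _ this).trans ?_
      rw [smul_eq_mul]
      gcongr
      simp
      omega
    calc n * Q.card = ∑ c ∈ Q, n := by simp [mul_comm]
      _ ≤ ∑ c ∈ Q, ((W.filter fun L' => f L' = c).card +
            if (W.filter fun L' => f L' = c).card < n then n else 0) := by
          refine Finset.sum_le_sum fun c _ => ?_
          split_ifs <;> omega
      _ = W.card + n * bad.card := by
          rw [Finset.sum_add_distrib, ← hsum, ← Finset.sum_filter, Finset.sum_const, smul_eq_mul,
            mul_comm n]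
      _ ≤ _ := by gcongr

end CyclicWords

/-! ### The transfer matrix of reduced words -/

section TransferMatrix

open FreeGroup Matrix

/-- The transfer matrix of reduced words with letters weighted by `z`: the entry at `(a, b)` is
`z a`, unless `b` is the inverse letter of `a`. -/
def transferMatrix {k : ℕ} (z : Fin k × Bool → ℂ) :
    Matrix (Fin k × Bool) (Fin k × Bool) ℂ :=
  Matrix.of fun a b => if a.1 = b.1 → a.2 = b.2 then z a else 0

variable {k : ℕ} {z : Fin k × Bool → ℂ}

theorem sum_fin_succ_ofFn {α : Type*} [Fintype α] (n : ℕ) (f : List α → ℂ) :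
    ∑ w : Fin (n + 1) → α, f (List.ofFn w) = ∑ a, ∑ w : Fin n → α, f (a :: List.ofFn w) := by
  rw [← Fintype.sum_prod_type']
  refine (Fintype.sum_equiv (Fin.consEquiv fun _ => α) _ _ ?_).symm
  rintro ⟨a, w⟩
  simp [Fin.consEquiv, List.ofFn_succ]

open Classical in
/-- The entries of the powers of the transfer matrix are sums over reduced words with prescribed
first letter `a` and with last letter `b`, the weight of `b` being left out. -/
theorem transferMatrix_pow_apply (n : ℕ) (a b : Fin k × Bool) :
    (transferMatrix z ^ (n + 1)) a b = ∑ w : Fin n → Fin k × Bool,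
      if FreeGroup.IsReduced (a :: (List.ofFn w ++ [b])) then ((a :: List.ofFn w).map z).prod
      else 0 := by
  induction n generalizing a with
  | zero => simp [transferMatrix, FreeGroup.IsReduced]
  | succ n ih =>
    rw [pow_succ', Matrix.mul_apply]
    simp_rw [ih]
    rw [sum_fin_succ_ofFn n (fun L => if FreeGroup.IsReduced (a :: (L ++ [b])) then
      ((a :: L).map z).prod else 0)]
    refine Finset.sum_congr rfl fun c _ => ?_
    rw [Finset.mul_sum]
    refine Finset.sum_congr rfl fun w _ => ?_
    simp only [transferMatrix, Matrix.of_apply, List.cons_append, isReduced_cons_cons]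
    by_cases h1 : a.1 = c.1 → a.2 = c.2 <;>
    by_cases h2 : FreeGroup.IsReduced (c :: (List.ofFn w ++ [b])) <;> simp [h1, h2]

theorem isReduced_cons_append_self_iff (a : Fin k × Bool) (L : List (Fin k × Bool)) :
    FreeGroup.IsReduced (a :: (L ++ [a])) ↔ IsCyclicallyReduced (a :: L) := by
  rw [← List.cons_append, FreeGroup.IsReduced, List.isChain_append]
  simp [IsCyclicallyReduced, FreeGroup.IsReduced]

/-- The sum over the cyclically reduced words of length `n` of the products of the weights of
their letters. -/
noncomputable def cyclicWordSum (n : ℕ) (z : Fin k × Bool → ℂ) : ℂ :=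
  ∑ L ∈ (cyclicWords_finite (Set.univ : Set (Fin k → ℤ)) n).toFinset, (L.map z).prod

theorem trace_transferMatrix_pow (n : ℕ) :
    (transferMatrix z ^ (n + 1)).trace = cyclicWordSum (n + 1) z := by
  classical
  simp_rw [Matrix.trace, Matrix.diag, transferMatrix_pow_apply, isReduced_cons_append_self_iff]
  rw [← sum_fin_succ_ofFn n (fun L => if IsCyclicallyReduced L then (L.map z).prod else 0),
    ← Finset.sum_filter, cyclicWordSum]
  refine Finset.sum_bij (fun w _ => List.ofFn w) ?_ ?_ ?_ ?_
  · intro w hw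
    simpa [cyclicWords] using hw
  · intro w _ w' _ h
    exact List.ofFn_injective h
  · intro L hL
    simp only [Set.Finite.mem_toFinset, cyclicWords, Set.mem_ofPred_eq] at hL
    have hof : List.ofFn (fun i : Fin (n + 1) => L[i.1]'(by omega)) = L :=
      List.ext_getElem (by rw [List.length_ofFn, hL.2.1]) fun i h1 h2 => by
        rw [List.getElem_ofFn]
    exact ⟨_, Finset.mem_filter.2 ⟨Finset.mem_univ _, by rw [hof]; exact hL.1⟩, hof⟩
  · intro w _
    rfl

theorem transferMatrix_mulVec (f : Fin k × Bool → ℂ) (a : Fin k × Bool) :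
    (transferMatrix z *ᵥ f) a = z a * (∑ b, f b - f (a.1, !a.2)) := by
  simp only [Matrix.mulVec, dotProduct, transferMatrix, Matrix.of_apply]
  rw [← Finset.add_sum_erase _ f (Finset.mem_univ (a.1, !a.2)), add_sub_cancel_left,
    ← Finset.add_sum_erase _ _ (Finset.mem_univ (a.1, !a.2)), Finset.mul_sum]
  simp only [forall_const]
  rw [if_neg (by simp), zero_mul, zero_add]
  refine Finset.sum_congr rfl fun b hb => ?_
  rw [if_pos]
  intro h
  by_contra h'
  refine (Finset.mem_erase.1 hb).1 (Prod.ext h.symm ?_)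
  revert h'
  cases a.2 <;> cases b.2 <;> simp

/-- The trace of the powers of the transfer matrix `M` when inverse letters have inverse weights.
For generic `z`, the vectors `z` and `1` span an invariant plane, on which `M` has characteristic
polynomial `λ ^ 2 - X λ + (2k - 1)` with `X = ∑ z a`; on the quotient `M` is minus an involution,
whose eigenvalues `1` and `-1` both have multiplicity `k - 1`. The proof avoids the decomposition:
`M ^ 2 - 1` has rank at most two, so that `trace M ^ (n + 2) - trace M ^ n` is a scalar sequence
that satisfies the recursion with that characteristic polynomial. -/
theorem trace_transferMatrix_pow_eq (hz : ∀ i b, z (i, !b) * z (i, b) = 1) {x y : ℂ}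
    (hxy : x + y = ∑ a, z a) (hmul : x * y = 2 * k - 1) (n : ℕ) :
    (transferMatrix z ^ n).trace = x ^ n + y ^ n + (k - 1) * (1 + (-1) ^ n) := by
  set M := transferMatrix z with hM
  set X := ∑ a, z a with hX
  set zi : Fin k × Bool → ℂ := fun a => z (a.1, !a.2) with hzi
  have hzz : ∀ a, z a * zi a = 1 := fun a => by rw [mul_comm]; exact hz a.1 a.2
  have hcard : (∑ _a : Fin k × Bool, (1 : ℂ)) = 2 * k := by
    simp [mul_comm]
  have hziX : ∑ a, zi a = X := by
    refine Fintype.sum_equiv ((Equiv.refl (Fin k)).prodCongr Equiv.boolNot) _ _ ?_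
    rintro ⟨i, b⟩
    simp [hzi]
  have hMz : M *ᵥ z = X • z - 1 := by
    ext a
    rw [hM, transferMatrix_mulVec]
    simp only [Pi.sub_apply, Pi.smul_apply, smul_eq_mul, Pi.one_apply]
    have := hzz a
    simp only [hzi] at this
    linear_combination -this
  have hM1 : M *ᵥ 1 = (2 * k - 1 : ℂ) • z := by
    ext a
    rw [hM, transferMatrix_mulVec]
    simp only [Pi.smul_apply, smul_eq_mul, Pi.one_apply, hcard]
    ring
  -- `M ^ 2 - 1` as a sum of two matrices of rank one
  have hMM : M * M = 1 + vecMulVec (M *ᵥ z) 1 - vecMulVec z zi := by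
    ext a b
    have h1 : (M * M) a b = (M *ᵥ fun c => M c b) a := rfl
    have h2 : (∑ c, M c b) = X - zi b := by
      rw [hX, ← Finset.add_sum_erase _ z (Finset.mem_univ (b.1, !b.2)), add_sub_cancel_left,
        ← Finset.add_sum_erase _ _ (Finset.mem_univ (b.1, !b.2))]
      simp only [hM, transferMatrix, Matrix.of_apply]
      rw [if_neg (by simp), zero_add]
      refine Finset.sum_congr rfl fun c hc => ?_
      rw [if_pos]
      intro h
      by_contra h'
      refine (Finset.mem_erase.1 hc).1 (Prod.ext h ?_)
      revert h'
      cases c.2 <;> cases b.2 <;> simp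
    rw [h1, hM, transferMatrix_mulVec, ← hM, h2, hMz]
    simp only [Matrix.sub_apply, Matrix.add_apply, vecMulVec_apply, Pi.sub_apply, Pi.smul_apply,
      smul_eq_mul, Pi.one_apply, mul_one, Matrix.one_apply]
    have h3 : M (a.1, !a.2) b = zi a - if a = b then zi a else 0 := by
      simp only [hM, transferMatrix, Matrix.of_apply, hzi]
      by_cases hab : a = b
      · subst hab
        simp
      · rw [if_pos, if_neg hab, sub_zero]
        intro h
        by_contra h'
        refine hab (Prod.ext h ?_)
        revert h'
        simp
    rw [h3]
    have := hzz a
    split_ifs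
    · ring
    · linear_combination -this
  have htr : ∀ n, (M ^ (n + 2)).trace - (M ^ n).trace =
      1 ⬝ᵥ (M ^ (n + 1) *ᵥ z) - zi ⬝ᵥ (M ^ n *ᵥ z) := by
    intro n
    have h1 : M ^ (n + 2) = M ^ n * (M * M) := by rw [pow_add, pow_two]
    rw [h1, hMM, mul_sub, mul_add, mul_one, trace_sub, trace_add, mul_vecMulVec, mul_vecMulVec,
      trace_vecMulVec, trace_vecMulVec, mulVec_mulVec, ← pow_succ, dotProduct_comm _ 1,
      dotProduct_comm _ zi]
    ring
  have hrec : ∀ n, M ^ (n + 2) *ᵥ z = X • (M ^ (n + 1) *ᵥ z) - (2 * k - 1 : ℂ) • (M ^ n *ᵥ z) := by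
    intro n
    rw [pow_succ, ← mulVec_mulVec, hMz, mulVec_sub, mulVec_smul]
    congr 1
    rw [pow_succ, ← mulVec_mulVec, hM1, mulVec_smul]
  set e : ℕ → ℂ := fun n => 1 ⬝ᵥ (M ^ (n + 1) *ᵥ z) - zi ⬝ᵥ (M ^ n *ᵥ z) with he
  have hzi_z : zi ⬝ᵥ z = 2 * k := by
    rw [← hcard]
    exact Finset.sum_congr rfl fun a _ => by rw [mul_comm]; exact hzz a
  have h1z : (1 : Fin k × Bool → ℂ) ⬝ᵥ z = X := by simp [dotProduct, hX]
  have h11 : (1 : Fin k × Bool → ℂ) ⬝ᵥ 1 = 2 * k := by rw [← hcard]; simp [dotProduct]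
  have hzi1 : zi ⬝ᵥ 1 = X := by rw [← hziX]; simp [dotProduct]
  have he_eq : ∀ n, e n = x ^ (n + 2) + y ^ (n + 2) - x ^ n - y ^ n := by
    have : ∀ n, e n = x ^ (n + 2) + y ^ (n + 2) - x ^ n - y ^ n ∧
        e (n + 1) = x ^ (n + 1 + 2) + y ^ (n + 1 + 2) - x ^ (n + 1) - y ^ (n + 1) := by
      intro n
      induction n with
      | zero =>
        simp only [he, hrec 0, zero_add, pow_one, pow_zero, one_mulVec, hMz, dotProduct_sub,
          dotProduct_smul, smul_eq_mul, h1z, h11, hzi_z, hzi1]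
        constructor
        · linear_combination (-(X + x + y)) * hxy + 2 * hmul
        · linear_combination (-(X ^ 2 + X * (x + y) + (x + y) ^ 2) + 3 * (x * y) + 1) * hxy
            + 3 * X * hmul
      | succ n ih =>
        refine ⟨ih.2, ?_⟩
        have : e (n + 1 + 1) = X * e (n + 1) - (2 * k - 1) * e n := by
          simp only [he, hrec (n + 1), hrec n, dotProduct_sub, dotProduct_smul, smul_eq_mul]
          ring
        rw [this, ih.1, ih.2]
        linear_combination
          (-(x ^ (n + 1 + 2) + y ^ (n + 1 + 2) - x ^ (n + 1) - y ^ (n + 1))) * hxy +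
          (x ^ (n + 2) + y ^ (n + 2) - x ^ n - y ^ n) * hmul
    exact fun n => (this n).1
  have key : ∀ n, (M ^ n).trace = x ^ n + y ^ n + (k - 1) * (1 + (-1) ^ n) ∧
      (M ^ (n + 1)).trace = x ^ (n + 1) + y ^ (n + 1) + (k - 1) * (1 + (-1) ^ (n + 1)) := by
    intro n
    induction n with
    | zero =>
      constructor
      · simp
        ring
      · simp only [zero_add, pow_one]
        rw [hxy, hX, Matrix.trace]
        simp [hM, transferMatrix]
    | succ n ih =>
      refine ⟨ih.2, ?_⟩
      have h := htr n
      rw [ih.1] at h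
      have h2 := he_eq n
      simp only [he] at h2
      rw [h2] at h
      linear_combination h
  exact (key n).1

end TransferMatrix

/-! ### The characteristic function as a function of the sum of cosines -/

noncomputable section Eigenvalues

open Complex (I)

/-- A square root of `s ^ 2 - (2k - 1)`; one of the two summands vanishes,
`Real.sqrt` being zero on negative numbers. -/
def discrRoot (k : ℕ) (s : ℝ) : ℂ := √(s ^ 2 - (2 * k - 1)) + √(2 * k - 1 - s ^ 2) * I

/-- The root `(s + √(s ^ 2 - q)) / q` of `q x ^ 2 - 2 s x + 1`, where `q = 2k - 1`. -/
def rootPlus (k : ℕ) (s : ℝ) : ℂ := (s + discrRoot k s) / (2 * k - 1)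

/-- The root `(s - √(s ^ 2 - q)) / q` of `q x ^ 2 - 2 s x + 1`, where `q = 2k - 1`. -/
def rootMinus (k : ℕ) (s : ℝ) : ℂ := (s - discrRoot k s) / (2 * k - 1)

/-- The normalised trace of the `n`-th power of the transfer matrix with weights `exp (± i θ_j)`,
as a function of `s = ∑ cos θ_j`. -/
def charFn (k n : ℕ) (s : ℝ) : ℂ :=
  rootPlus k s ^ n + rootMinus k s ^ n + (k - 1) * (1 + (-1) ^ n) / (2 * k - 1) ^ n

variable {k : ℕ} {s : ℝ}

theorem discrRoot_sq (k : ℕ) (s : ℝ) : discrRoot k s ^ 2 = s ^ 2 - (2 * k - 1) := by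
  rcases le_total (s ^ 2) (2 * k - 1) with h | h
  · rw [discrRoot, Real.sqrt_eq_zero_of_nonpos (by linarith)]
    have h2 : ((√(2 * k - 1 - s ^ 2) : ℝ) : ℂ) ^ 2 = 2 * k - 1 - s ^ 2 := by
      rw [← Complex.ofReal_pow, Real.sq_sqrt (by linarith)]
      push_cast
      ring
    rw [Complex.ofReal_zero, zero_add, mul_pow, Complex.I_sq, h2]
    ring
  · rw [discrRoot, Real.sqrt_eq_zero_of_nonpos (by linarith : 2 * k - 1 - s ^ 2 ≤ 0)]
    rw [Complex.ofReal_zero, zero_mul, add_zero, ← Complex.ofReal_pow,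
      Real.sq_sqrt (by linarith)]
    push_cast
    ring

theorem card_letters_sub_one_ge (hk : 2 ≤ k) : (3 : ℝ) ≤ 2 * k - 1 := by
  have : (2 : ℝ) ≤ k := by exact_mod_cast hk
  linarith

theorem card_letters_sub_one_ne_zero (hk : 2 ≤ k) : (2 * k - 1 : ℂ) ≠ 0 := by
  have h := card_letters_sub_one_ge hk
  have : ((2 * k - 1 : ℝ) : ℂ) ≠ 0 := by
    rw [Complex.ofReal_ne_zero]
    linarith
  push_cast at this
  exact this

theorem rootPlus_add_rootMinus (hk : 2 ≤ k) (s : ℝ) :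
    (2 * k - 1) * rootPlus k s + (2 * k - 1) * rootMinus k s = 2 * s := by
  have := card_letters_sub_one_ne_zero hk
  rw [rootPlus, rootMinus]
  field_simp
  ring

theorem rootPlus_mul_rootMinus (hk : 2 ≤ k) (s : ℝ) :
    ((2 * k - 1) * rootPlus k s) * ((2 * k - 1) * rootMinus k s) = 2 * k - 1 := by
  have := card_letters_sub_one_ne_zero hk
  rw [rootPlus, rootMinus]
  field_simp
  linear_combination -(discrRoot_sq k s)

theorem exp_neg_one_ge : (1 / 3 : ℝ) ≤ Real.exp (-1) := by
  rw [Real.exp_neg, one_div]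
  have := Real.exp_one_lt_d9
  exact inv_anti₀ (Real.exp_pos 1) (by linarith)

theorem inv_card_letters_le (hk : 2 ≤ k) : 1 / (2 * k - 1 : ℝ) ≤ Real.exp (-1) := by
  have h := card_letters_sub_one_ge hk
  refine le_trans ?_ exp_neg_one_ge
  exact one_div_le_one_div_of_le (by norm_num) h

theorem norm_le_of_sq_mul_le (hk : 2 ≤ k) {r : ℂ} (h : (2 * k - 1) * ‖r‖ ^ 2 ≤ 1) :
    ‖r‖ ≤ Real.exp (-1 / 2) := by
  have hq := card_letters_sub_one_ge hk
  have h1 : ‖r‖ ^ 2 ≤ Real.exp (-1 / 2) ^ 2 := by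
    rw [← Real.exp_nat_mul]
    norm_num
    refine le_trans ?_ exp_neg_one_ge
    nlinarith [sq_nonneg ‖r‖]
  exact le_of_sq_le_sq h1 (Real.exp_pos _).le

/-- Away from the range where the roots are complex conjugate, the larger root is real. -/
theorem rootPlus_of_le (h : 2 * k - 1 ≤ s ^ 2) :
    rootPlus k s = ((s + √(s ^ 2 - (2 * k - 1))) / (2 * k - 1) : ℝ) := by
  rw [rootPlus, discrRoot, Real.sqrt_eq_zero_of_nonpos (by linarith : 2 * k - 1 - s ^ 2 ≤ 0)]
  push_cast
  ring

theorem rootMinus_of_le (h : 2 * k - 1 ≤ s ^ 2) :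
    rootMinus k s = ((s - √(s ^ 2 - (2 * k - 1))) / (2 * k - 1) : ℝ) := by
  rw [rootMinus, discrRoot, Real.sqrt_eq_zero_of_nonpos (by linarith : 2 * k - 1 - s ^ 2 ≤ 0)]
  push_cast
  ring

theorem norm_roots_of_le (hk : 2 ≤ k) (h : s ^ 2 ≤ 2 * k - 1) :
    ‖rootPlus k s‖ ≤ Real.exp (-1 / 2) ∧ ‖rootMinus k s‖ ≤ Real.exp (-1 / 2) := by
  have hq := card_letters_sub_one_ge hk
  have hd : discrRoot k s = √(2 * k - 1 - s ^ 2) * I := by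
    rw [discrRoot, Real.sqrt_eq_zero_of_nonpos (by linarith)]
    simp
  have hn : ‖(2 * k - 1 : ℂ)‖ = 2 * k - 1 := by
    rw [show (2 * k - 1 : ℂ) = ((2 * k - 1 : ℝ) : ℂ) by push_cast; ring, Complex.norm_real,
      Real.norm_eq_abs, abs_of_nonneg (by linarith)]
  have h1 : ‖(s + discrRoot k s : ℂ)‖ ^ 2 = 2 * k - 1 := by
    rw [hd, Complex.sq_norm, Complex.normSq_add_mul_I, Real.sq_sqrt (by linarith)]
    ring
  have h2 : ‖(s - discrRoot k s : ℂ)‖ ^ 2 = 2 * k - 1 := by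
    rw [hd, Complex.sq_norm, sub_eq_add_neg, ← neg_mul, ← Complex.ofReal_neg,
      Complex.normSq_add_mul_I, neg_sq, Real.sq_sqrt (by linarith)]
    ring
  constructor
  · apply norm_le_of_sq_mul_le hk
    rw [rootPlus, norm_div, hn, div_pow, h1]
    field_simp
    linarith
  · apply norm_le_of_sq_mul_le hk
    rw [rootMinus, norm_div, hn, div_pow, h2]
    field_simp
    linarith

theorem real_root_bounds (hk : 2 ≤ k) (h0 : 0 ≤ s) (hs : s ≤ k) (h : 2 * k - 1 ≤ s ^ 2) :
    0 < (s + √(s ^ 2 - (2 * k - 1))) / (2 * k - 1) ∧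
    (s + √(s ^ 2 - (2 * k - 1))) / (2 * k - 1) ≤ Real.exp (-(k - s) / (k - 1)) ∧
    (2 * k - 1) * ((s - √(s ^ 2 - (2 * k - 1))) / (2 * k - 1)) ^ 2 ≤ 1 := by
  have hq := card_letters_sub_one_ge hk
  have hk1 : (1 : ℝ) ≤ k - 1 := by linarith
  set u := √(s ^ 2 - (2 * k - 1)) with hu
  have hu0 : 0 ≤ u := Real.sqrt_nonneg _
  have hu2 : u ^ 2 = s ^ 2 - (2 * k - 1) := Real.sq_sqrt (by linarith)
  have hs0 : 0 < s := by nlinarith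
  refine ⟨by positivity, ?_, ?_⟩
  · have h1 : u ≤ (k * s - (2 * k - 1)) / (k - 1) := by
      rw [le_div_iff₀ (by linarith)]
      have h3 : 0 ≤ k * s - (2 * k - 1) := by nlinarith
      refine le_of_sq_le_sq ?_ h3
      rw [mul_pow, hu2]
      nlinarith [mul_nonneg (by linarith : (0 : ℝ) ≤ 2 * k - 1) (sq_nonneg (s - k))]
    have h2 : (s + u) / (2 * k - 1) ≤ -(k - s) / (k - 1) + 1 := by
      have : (s + u) / (2 * k - 1) ≤ (s + (k * s - (2 * k - 1)) / (k - 1)) / (2 * k - 1) := by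
        gcongr
      refine this.trans (le_of_eq ?_)
      have h4 : (k - 1 : ℝ) ≠ 0 := by linarith
      have h5 : (2 * k - 1 : ℝ) ≠ 0 := by linarith
      rw [div_eq_iff h5]
      field_simp
      ring
    exact h2.trans (Real.add_one_le_exp _)
  · have hus : u ≤ s := by
      refine le_of_sq_le_sq ?_ h0
      linarith
    rw [div_pow]
    have : (2 * k - 1) * ((s - u) ^ 2 / (2 * k - 1) ^ 2) = (s - u) ^ 2 / (2 * k - 1 : ℝ) := by
      field_simp
    rw [this, div_le_one (by linarith)]
    nlinarith

theorem discrRoot_neg (k : ℕ) (s : ℝ) : discrRoot k (-s) = discrRoot k s := by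
  simp [discrRoot]

theorem rootPlus_neg (k : ℕ) (s : ℝ) : rootPlus k (-s) = -rootMinus k s := by
  rw [rootPlus, rootMinus, discrRoot_neg]
  push_cast
  ring

theorem rootMinus_neg (k : ℕ) (s : ℝ) : rootMinus k (-s) = -rootPlus k s := by
  rw [rootPlus, rootMinus, discrRoot_neg]
  push_cast
  ring

/-- The dichotomy for the two roots when `0 ≤ s ≤ k`: both are small, or one is real and
positive and satisfies the exponential bound that comes from the tangent line at `s = k`. -/
theorem roots_dichotomy (hk : 2 ≤ k) (h0 : 0 ≤ s) (hs : s ≤ k) :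
    ‖rootMinus k s‖ ≤ Real.exp (-1 / 2) ∧ (‖rootPlus k s‖ ≤ Real.exp (-1 / 2) ∨
      ∃ x : ℝ, 0 < x ∧ x ≤ Real.exp (-(k - s) / (2 * k)) ∧ rootPlus k s = x) := by
  have hq := card_letters_sub_one_ge hk
  rcases le_total (s ^ 2) (2 * k - 1) with h | h
  · exact ⟨(norm_roots_of_le hk h).2, Or.inl (norm_roots_of_le hk h).1⟩
  · obtain ⟨h1, h2, h3⟩ := real_root_bounds hk h0 hs h
    refine ⟨?_, Or.inr ⟨_, h1, h2.trans ?_, rootPlus_of_le h⟩⟩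
    · apply norm_le_of_sq_mul_le hk
      rw [rootMinus_of_le h, Complex.norm_real, Real.norm_eq_abs, sq_abs]
      exact h3
    · rw [Real.exp_le_exp, neg_div, neg_div, neg_le_neg_iff]
      exact div_le_div_of_nonneg_left (by linarith) (by linarith) (by linarith)

theorem charFn_neg (k n : ℕ) (s : ℝ) : charFn k n (-s) = (-1) ^ n * charFn k n s := by
  have h : ((-1 : ℂ) ^ n) * (-1) ^ n = 1 := by rw [← mul_pow]; simp
  simp only [charFn, rootPlus_neg, rootMinus_neg]
  rw [neg_pow, neg_pow (rootPlus k s)]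
  linear_combination -((k - 1) / (2 * k - 1 : ℂ) ^ n) * h

/-- The contribution of the trivial eigenvalues `± 1` of the transfer matrix is exponentially
small. -/
theorem norm_charFn_term_le (hk : 2 ≤ k) (n : ℕ) :
    ‖((k : ℂ) - 1) * (1 + (-1) ^ n) / (2 * k - 1) ^ n‖ ≤
      2 * (k - 1) * Real.exp (-1) ^ n := by
  have hq := card_letters_sub_one_ge hk
  have hn : ‖(2 * k - 1 : ℂ)‖ = 2 * k - 1 := by
    rw [show (2 * k - 1 : ℂ) = ((2 * k - 1 : ℝ) : ℂ) by push_cast; ring, Complex.norm_real,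
      Real.norm_eq_abs, abs_of_nonneg (by linarith)]
  have hk1 : ‖((k : ℂ) - 1)‖ = k - 1 := by
    rw [show ((k : ℂ) - 1) = ((k - 1 : ℝ) : ℂ) by push_cast; ring, Complex.norm_real,
      Real.norm_eq_abs, abs_of_nonneg (by linarith)]
  have h2 : ‖(1 + (-1) ^ n : ℂ)‖ ≤ 2 := by
    refine (norm_add_le _ _).trans ?_
    simp
    norm_num
  rw [norm_div, norm_mul, norm_pow, hn, hk1, div_eq_mul_one_div, ← one_div_pow]
  have h3 := inv_card_letters_le hk
  have h4 : (0 : ℝ) ≤ 1 / (2 * k - 1) := by positivity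
  calc ((k : ℝ) - 1) * ‖(1 + (-1) ^ n : ℂ)‖ * (1 / (2 * k - 1)) ^ n
      ≤ (k - 1) * 2 * Real.exp (-1) ^ n := by
        have : (0 : ℝ) ≤ k - 1 := by linarith
        gcongr
    _ = _ := by ring

/-- The characteristic function decays exponentially in `n` away from `s = ± k`. Since
`k - |∑ cos θ_j|` is quadratic in `θ` near the maxima, this is a Gaussian bound there. -/
theorem norm_charFn_le (hk : 2 ≤ k) (n : ℕ) (hs : |s| ≤ k) :
    ‖charFn k n s‖ ≤ 2 * k * Real.exp (-(n * (k - |s|) / (2 * k))) := by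
  have hq := card_letters_sub_one_ge hk
  wlog h0 : 0 ≤ s generalizing s
  · have := this (s := -s) (by rwa [abs_neg]) (by linarith)
    rw [charFn_neg, norm_mul, norm_pow, norm_neg, norm_one, one_pow, one_mul, abs_neg] at this
    exact this
  rw [abs_of_nonneg h0] at hs ⊢
  obtain ⟨h1, h2⟩ := roots_dichotomy hk h0 hs
  set E := Real.exp (-(k - s) / (2 * k)) with hE
  have hEn : Real.exp (-(n * (k - s) / (2 * k))) = E ^ n := by
    rw [hE, ← Real.exp_nat_mul]
    congr 1
    ring
  have hhalf : Real.exp (-1 / 2) ≤ E := by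
    rw [hE, Real.exp_le_exp, div_le_div_iff₀ (by norm_num) (by linarith)]
    linarith
  have hone : Real.exp (-1) ≤ E := le_trans (Real.exp_le_exp.2 (by norm_num)) hhalf
  have h3 : ‖rootPlus k s‖ ≤ E := by
    rcases h2 with h2 | ⟨x, hx0, hx, h2⟩
    · exact h2.trans hhalf
    · rw [h2, Complex.norm_real, Real.norm_eq_abs, abs_of_pos hx0]
      exact hx
  have h4 : ‖rootMinus k s‖ ≤ E := h1.trans hhalf
  rw [hEn, charFn]
  calc _ ≤ ‖rootPlus k s‖ ^ n + ‖rootMinus k s‖ ^ n +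
        ‖((k : ℂ) - 1) * (1 + (-1) ^ n) / (2 * k - 1) ^ n‖ := by
        rw [← norm_pow, ← norm_pow]
        exact norm_add₃_le
    _ ≤ E ^ n + E ^ n + 2 * (k - 1) * E ^ n := by
        refine add_le_add (by gcongr) ((norm_charFn_term_le hk n).trans ?_)
        have : (0 : ℝ) ≤ 2 * (k - 1) := by linarith
        gcongr
    _ = 2 * k * E ^ n := by ring

theorem exp_half_pow_le {δ : ℝ} (hδ : δ ≤ 1 / 2) {n : ℕ} (hn : 0 < n) :
    Real.exp (-1 / 2) ^ n ≤ 4 / n * Real.exp (-(n * δ / 2)) := by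
  have hn' : (0 : ℝ) < n := by exact_mod_cast hn
  have h1 : Real.exp (-1 / 2) ^ n = Real.exp (-(n / 4)) * Real.exp (-(n / 4)) := by
    rw [← Real.exp_nat_mul, ← Real.exp_add]
    congr 1
    ring
  rw [h1]
  have h2 : Real.exp (-(n / 4 : ℝ)) ≤ 4 / n := by
    rw [Real.exp_neg, inv_le_comm₀ (Real.exp_pos _) (by positivity), inv_div]
    have := Real.add_one_le_exp (n / 4 : ℝ)
    linarith
  have h3 : Real.exp (-(n / 4 : ℝ)) ≤ Real.exp (-(n * δ / 2)) := by
    rw [Real.exp_le_exp]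
    nlinarith
  gcongr

theorem norm_pow_sub_pow_succ_le {r : ℂ} {δ : ℝ} (hδ : δ ≤ 1 / 2) {n : ℕ} (hn : 0 < n)
    (hr : ‖r‖ ≤ Real.exp (-1 / 2)) :
    ‖r ^ n - r ^ (n + 1)‖ ≤ 8 / n * Real.exp (-(n * δ / 2)) := by
  have h1 := exp_half_pow_le hδ hn
  have hle : Real.exp (-1 / 2) ≤ 1 := Real.exp_le_one_iff.2 (by norm_num)
  calc ‖r ^ n - r ^ (n + 1)‖ ≤ ‖r ^ n‖ + ‖r ^ (n + 1)‖ := norm_sub_le _ _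
    _ = ‖r‖ ^ n + ‖r‖ ^ n * ‖r‖ := by rw [norm_pow, norm_pow, pow_succ]
    _ ≤ Real.exp (-1 / 2) ^ n + Real.exp (-1 / 2) ^ n * 1 := by
        gcongr
        exact hr.trans hle
    _ ≤ 8 / n * Real.exp (-(n * δ / 2)) := by
        have : (8 : ℝ) / n * Real.exp (-(n * δ / 2)) =
          2 * (4 / n * Real.exp (-(n * δ / 2))) := by ring
        rw [this]
        linarith

theorem pow_mul_one_sub_le {x δ : ℝ} (hδ : 0 ≤ δ) {n : ℕ} (hn : 0 < n) (hx0 : 0 < x)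
    (hx : x ≤ Real.exp (-δ)) :
    |x ^ n - x ^ (n + 1)| ≤ 2 / n * Real.exp (-(n * δ / 2)) := by
  have hn' : (0 : ℝ) < n := by exact_mod_cast hn
  obtain ⟨y, rfl⟩ : ∃ y, x = Real.exp (-y) := ⟨-Real.log x, by rw [neg_neg, Real.exp_log hx0]⟩
  rw [Real.exp_le_exp, neg_le_neg_iff] at hx
  have hle : Real.exp (-y) ≤ 1 := Real.exp_le_one_iff.2 (by linarith)
  have h1 : 1 - Real.exp (-y) ≤ y := by
    have := Real.add_one_le_exp (-y)
    linarith
  have h2 : Real.exp (-y) ^ n = Real.exp (-(n * y / 2)) * Real.exp (-(n * y / 2)) := by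
    rw [← Real.exp_nat_mul, ← Real.exp_add]
    congr 1
    ring
  have h3 : Real.exp (-(n * y / 2)) ≤ Real.exp (-(n * δ / 2)) := by
    rw [Real.exp_le_exp]
    have := mul_le_mul_of_nonneg_left hx hn'.le
    linarith
  have h4 : y * Real.exp (-(n * y / 2)) ≤ 2 / n := by
    rw [Real.exp_neg, ← div_eq_mul_inv, div_le_div_iff₀ (Real.exp_pos _) hn']
    have := Real.add_one_le_exp (n * y / 2)
    linarith
  rw [pow_succ, abs_of_nonneg (by nlinarith [pow_pos (Real.exp_pos (-y)) n])]
  calc Real.exp (-y) ^ n - Real.exp (-y) ^ n * Real.exp (-y)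
      = Real.exp (-y) ^ n * (1 - Real.exp (-y)) := by ring
    _ ≤ Real.exp (-y) ^ n * y := by gcongr
    _ = (y * Real.exp (-(n * y / 2))) * Real.exp (-(n * y / 2)) := by rw [h2]; ring
    _ ≤ 2 / n * Real.exp (-(n * δ / 2)) := by gcongr

/-- Near `s = -k` the dominant eigenvalue is close to `-1`, so that the characteristic functions
of two consecutive lengths cancel up to a factor of order `1 / n`. -/
theorem norm_charFn_add_succ_le (hk : 2 ≤ k) {n : ℕ} (hn : 0 < n) (hs : |s| ≤ k) (h0 : s ≤ 0) :
    ‖charFn k n s + charFn k (n + 1) s‖ ≤ 16 * k / n * Real.exp (-(n * (k + s) / (4 * k))) := by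
  have hq := card_letters_sub_one_ge hk
  have hn' : (0 : ℝ) < n := by exact_mod_cast hn
  have hn1 : (1 : ℝ) ≤ n := by exact_mod_cast hn
  obtain ⟨t, rfl⟩ : ∃ t, s = -t := ⟨-s, by ring⟩
  have ht0 : 0 ≤ t := by linarith
  rw [abs_neg, abs_of_nonneg ht0] at hs
  obtain ⟨h1, h2⟩ := roots_dichotomy hk ht0 hs
  -- in terms of `t = -s` the sum becomes a difference of consecutive powers of the eigenvalues
  set δ := (k - t) / (2 * k) with hδ
  have hδ0 : 0 ≤ δ := div_nonneg (by linarith) (by linarith)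
  have hδ1 : δ ≤ 1 / 2 := by
    rw [hδ, div_le_div_iff₀ (by linarith) (by norm_num)]
    linarith
  have hE : Real.exp (-(n * (k + -t) / (4 * k))) = Real.exp (-(n * δ / 2)) := by
    rw [hδ]
    congr 1
    ring
  rw [hE]
  set E := Real.exp (-(n * δ / 2)) with hEdef
  have h3 : ‖rootPlus k t ^ n - rootPlus k t ^ (n + 1)‖ ≤ 8 / n * E := by
    rcases h2 with h2 | ⟨x, hx0, hx, h2⟩
    · exact norm_pow_sub_pow_succ_le hδ1 hn h2
    · rw [h2, ← Complex.ofReal_pow, ← Complex.ofReal_pow, ← Complex.ofReal_sub,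
        Complex.norm_real, Real.norm_eq_abs]
      rw [neg_div] at hx
      refine (pow_mul_one_sub_le hδ0 hn hx0 hx).trans ?_
      gcongr
      norm_num
  have h4 : ‖rootMinus k t ^ n - rootMinus k t ^ (n + 1)‖ ≤ 8 / n * E :=
    norm_pow_sub_pow_succ_le hδ1 hn h1
  have h5 : ∀ m, n ≤ m → ‖((k : ℂ) - 1) * (1 + (-1) ^ m) / (2 * k - 1) ^ m‖ ≤
      2 * (k - 1) * (4 / n * E) := by
    intro m hm
    refine (norm_charFn_term_le hk m).trans ?_
    have : (0 : ℝ) ≤ 2 * (k - 1) := by linarith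
    have h6 : Real.exp (-1) ^ m ≤ Real.exp (-1 / 2) ^ n := by
      calc Real.exp (-1) ^ m ≤ Real.exp (-1) ^ n :=
            pow_le_pow_of_le_one (Real.exp_pos _).le (Real.exp_le_one_iff.2 (by norm_num)) hm
        _ ≤ _ := by
            gcongr
            norm_num
    have := exp_half_pow_le hδ1 hn
    gcongr
    exact h6.trans this
  rw [charFn_neg, charFn_neg]
  have h7 : (-1 : ℂ) ^ n * charFn k n t + (-1) ^ (n + 1) * charFn k (n + 1) t =
      (-1) ^ n * ((rootPlus k t ^ n - rootPlus k t ^ (n + 1)) +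
        (rootMinus k t ^ n - rootMinus k t ^ (n + 1)) +
        (((k : ℂ) - 1) * (1 + (-1) ^ n) / (2 * k - 1) ^ n -
          ((k : ℂ) - 1) * (1 + (-1) ^ (n + 1)) / (2 * k - 1) ^ (n + 1))) := by
    rw [charFn, charFn, pow_succ (-1 : ℂ)]
    ring
  rw [h7, norm_mul, norm_pow, norm_neg, norm_one, one_pow, one_mul]
  calc _ ≤ 8 / n * E + 8 / n * E + (2 * (k - 1) * (4 / n * E) + 2 * (k - 1) * (4 / n * E)) := by
        refine norm_add₃_le.trans (add_le_add (add_le_add h3 h4) ?_)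
        exact (norm_sub_le _ _).trans (add_le_add (h5 n le_rfl) (h5 (n + 1) (by omega)))
    _ = _ := by ring

theorem tendsto_sqrt_discr (hk : 2 ≤ k) {u : ℕ → ℝ} (hu : Tendsto u atTop (𝓝 (k : ℝ))) :
    Tendsto (fun n => √(u n ^ 2 - (2 * k - 1))) atTop (𝓝 (k - 1 : ℝ)) := by
  have hq := card_letters_sub_one_ge hk
  have h1 : √((k : ℝ) ^ 2 - (2 * k - 1)) = k - 1 := by
    rw [show (k : ℝ) ^ 2 - (2 * k - 1) = (k - 1) ^ 2 by ring, Real.sqrt_sq (by linarith)]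
  rw [← h1]
  exact (Real.continuous_sqrt.tendsto _).comp ((hu.pow 2).sub_const _)

/-- The characteristic function at the scale `s = k - τ / n`. There the larger root is
`1 - τ / ((k - 1) n) + o(1 / n)`, and all other eigenvalues are bounded away from `1`, so that the
limit is `exp (-τ / (k - 1))`, for the lengths `n` and `n + 1` alike. -/
theorem tendsto_charFn (hk : 2 ≤ k) {u : ℕ → ℝ} {τ : ℝ} (hle : ∀ n, |u n| ≤ k)
    (hτ : Tendsto (fun n : ℕ => n * (k - u n)) atTop (𝓝 τ)) :
    Tendsto (fun n => charFn k n (u n)) atTop (𝓝 (Real.exp (-τ / (k - 1)) : ℝ)) ∧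
    Tendsto (fun n => charFn k (n + 1) (u n)) atTop (𝓝 (Real.exp (-τ / (k - 1)) : ℝ)) := by
  have hq := card_letters_sub_one_ge hk
  have hk1 : (0 : ℝ) < k - 1 := by linarith
  have hu : Tendsto u atTop (𝓝 (k : ℝ)) := by
    have h1 : Tendsto (fun n : ℕ => k - u n) atTop (𝓝 0) := by
      have h2 := hτ.mul (tendsto_inv_atTop_nhds_zero_nat (𝕜 := ℝ))
      rw [mul_zero] at h2
      refine h2.congr' ?_
      filter_upwards [eventually_gt_atTop 0] with n hn
      have : (n : ℝ) ≠ 0 := by positivity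
      field_simp
    have h2 := h1.const_sub (k : ℝ)
    simpa using h2
  have hv := tendsto_sqrt_discr hk hu
  set v : ℕ → ℝ := fun n => √(u n ^ 2 - (2 * k - 1)) with hvdef
  have hev : ∀ᶠ n in atTop, 2 * k - 1 ≤ u n ^ 2 := by
    have : ((2 : ℝ) * k - 1) < (k : ℝ) ^ 2 := by nlinarith
    exact ((hu.pow 2).eventually_const_lt this).mono fun n hn => hn.le
  have hev0 : ∀ᶠ n in atTop, 0 ≤ u n :=
    (hu.eventually_const_lt (by linarith : (0 : ℝ) < k)).mono fun n hn => hn.le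
  -- the larger root, as `1 + O(1 / n)`
  set R : ℕ → ℝ := fun n => (u n + v n) / (2 * k - 1) with hR
  have hR1 : Tendsto R atTop (𝓝 1) := by
    have := (hu.add hv).div_const (2 * k - 1 : ℝ)
    rwa [show ((k : ℝ) + (k - 1)) / (2 * k - 1) = 1 by
      rw [div_eq_one_iff_eq (by linarith)]; ring] at this
  -- rationalise `v n - (k - 1)`, where `k - 1` is the value of the square root at `s = k`
  have hnR : Tendsto (fun n : ℕ => n * (R n - 1)) atTop (𝓝 (-τ / (k - 1))) := by
    have h1 : Tendsto (fun n : ℕ => -(n * (k - u n)) *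
        ((1 + (u n + k) / (v n + (k - 1))) / (2 * k - 1))) atTop
        (𝓝 (-τ * ((1 + (k + k) / ((k - 1) + (k - 1))) / (2 * k - 1)))) := by
      refine hτ.neg.mul (Tendsto.div_const (Tendsto.const_add _ (Tendsto.div
        (hu.add_const _) (hv.add_const _) ?_)) _)
      linarith
    have h2 : -τ * ((1 + ((k : ℝ) + k) / ((k - 1) + (k - 1))) / (2 * k - 1)) = -τ / (k - 1) := by
      have h3 : (k - 1 : ℝ) ≠ 0 := hk1.ne'
      have h4 : (2 * k - 1 : ℝ) ≠ 0 := by linarith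
      have h5 : ((k : ℝ) + k) / ((k - 1) + (k - 1)) = k / (k - 1) := by
        rw [← two_mul, ← two_mul, mul_div_mul_left _ _ two_ne_zero]
      have h6 : 1 + (k : ℝ) / (k - 1) = (2 * k - 1) / (k - 1) := by
        field_simp
        ring
      rw [h5, h6]
      field_simp
    rw [h2] at h1
    refine h1.congr' ?_
    filter_upwards [hev] with n hn
    have hv2 : v n ^ 2 = u n ^ 2 - (2 * k - 1) := Real.sq_sqrt (by linarith)
    have hv0 : 0 ≤ v n := Real.sqrt_nonneg _
    have h3 : v n + (k - 1) ≠ 0 := by linarith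
    have h4 : (2 * k - 1 : ℝ) ≠ 0 := by linarith
    simp only [hR]
    rw [show -(n * (k - u n)) * ((1 + (u n + k) / (v n + (k - 1))) / (2 * k - 1)) =
      n * (-(k - u n) * ((1 + (u n + k) / (v n + (k - 1))) / (2 * k - 1))) by ring]
    congr 1
    rw [← mul_div_assoc, div_sub_one h4]
    congr 1
    have h5 : (u n + k) / (v n + (k - 1)) * (k - u n) = -(v n - (k - 1)) := by
      rw [div_mul_eq_mul_div, div_eq_iff h3]
      linear_combination hv2
    linear_combination -h5
  have hRn : Tendsto (fun n : ℕ => R n ^ n) atTop (𝓝 (Real.exp (-τ / (k - 1)))) := by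
    have := Real.tendsto_one_add_pow_exp_of_tendsto hnR
    simpa using this
  have hexp0 : Tendsto (fun n : ℕ => Real.exp (-1 / 2) ^ n) atTop (𝓝 0) :=
    tendsto_pow_atTop_nhds_zero_of_lt_one (Real.exp_pos _).le
      (Real.exp_lt_one_iff.2 (by norm_num))
  have hexp1 : Tendsto (fun n : ℕ => 2 * (k - 1) * Real.exp (-1) ^ n) atTop (𝓝 0) := by
    have : Tendsto (fun n : ℕ => Real.exp (-1) ^ n) atTop (𝓝 0) :=
      tendsto_pow_atTop_nhds_zero_of_lt_one (Real.exp_pos _).le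
        (Real.exp_lt_one_iff.2 (by norm_num))
    simpa using this.const_mul (2 * (k - 1 : ℝ))
  have hplus : ∀ᶠ n in atTop, rootPlus k (u n) = (R n : ℝ) := by
    filter_upwards [hev] with n hn
    exact rootPlus_of_le hn
  have hminus : ∀ᶠ n in atTop, ‖rootMinus k (u n)‖ ≤ Real.exp (-1 / 2) := by
    filter_upwards [hev0] with n hn
    exact (roots_dichotomy hk hn ((le_abs_self _).trans (hle n))).1
  have hgen : ∀ j : ℕ, Tendsto (fun n => charFn k (n + j) (u n)) atTop
      (𝓝 (Real.exp (-τ / (k - 1)) : ℝ)) := by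
    intro j
    have h1 : Tendsto (fun n => rootPlus k (u n) ^ (n + j)) atTop
        (𝓝 ((Real.exp (-τ / (k - 1)) : ℝ) : ℂ)) := by
      have h2 : Tendsto (fun n => R n ^ n * R n ^ j) atTop (𝓝 (Real.exp (-τ / (k - 1)))) := by
        simpa using hRn.mul (hR1.pow j)
      refine ((Complex.continuous_ofReal.tendsto _).comp h2).congr' ?_
      filter_upwards [hplus] with n hn
      rw [hn, pow_add]
      simp
    have h2 : Tendsto (fun n => rootMinus k (u n) ^ (n + j)) atTop (𝓝 0) := by
      refine squeeze_zero_norm' ?_ (hexp0.comp (tendsto_add_atTop_nat j))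
      filter_upwards [hminus] with n hn
      rw [norm_pow]
      exact pow_le_pow_left₀ (norm_nonneg _) hn _
    have h3 : Tendsto (fun n : ℕ => ((k : ℂ) - 1) * (1 + (-1) ^ (n + j)) / (2 * k - 1) ^ (n + j))
        atTop (𝓝 0) :=
      squeeze_zero_norm (fun n => norm_charFn_term_le hk (n + j))
        (hexp1.comp (tendsto_add_atTop_nat j))
    simpa [charFn] using (h1.add h2).add h3
  exact ⟨hgen 0, hgen 1⟩

end Eigenvalues

/-! ### Fourier inversion -/

noncomputable section FourierInversion

open MeasureTheory
open Complex (I)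

variable {k : ℕ}

/-- The unitary weights `exp (± i θ_j)` of the letters `A_j ^ (±1)`. -/
def phase (θ : Fin k → ℝ) (a : Fin k × Bool) : ℂ :=
  Complex.exp ((if a.2 then θ a.1 else -θ a.1 : ℝ) * I)

theorem phase_mul (θ : Fin k → ℝ) (i : Fin k) (b : Bool) :
    phase θ (i, !b) * phase θ (i, b) = 1 := by
  rw [phase, phase, ← Complex.exp_add, ← add_mul, ← Complex.ofReal_add]
  cases b <;> simp

theorem sum_phase (θ : Fin k → ℝ) : ∑ a, phase θ a = 2 * (∑ i, Real.cos (θ i) : ℝ) := by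
  rw [Fintype.sum_prod_type]
  push_cast
  rw [Finset.mul_sum]
  refine Finset.sum_congr rfl fun i _ => ?_
  simp [phase, Complex.cos]
  ring

theorem logVector_one : logVector (1 : FreeGroup (Fin k)) = 0 := by
  ext j
  simp [logVector]

theorem logVector_mul (g h : FreeGroup (Fin k)) :
    logVector (g * h) = logVector g + logVector h := by
  ext j
  simp [logVector]

theorem prod_phase (θ : Fin k → ℝ) (L : List (Fin k × Bool)) :
    (L.map (phase θ)).prod =
      Complex.exp ((∑ j, θ j * logVector (FreeGroup.mk L) j : ℝ) * I) := by
  induction L with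
  | nil =>
    have : logVector (FreeGroup.mk ([] : List (Fin k × Bool))) = 0 := logVector_one
    simp [this]
  | cons a L ih =>
    rw [List.map_cons, List.prod_cons, ih, FreeGroup.mk_cons, logVector_mul, phase,
      ← Complex.exp_add, ← add_mul, ← Complex.ofReal_add]
    congr 3
    simp only [Pi.add_apply, Int.cast_add, mul_add, Finset.sum_add_distrib]
    congr 1
    obtain ⟨i, b⟩ := a
    have : ∀ j, logVector (FreeGroup.mk [(i, b)]) j =
        if i = j then (if b then 1 else -1) else 0 := by
      intro j
      simp only [logVector, discreteLog, FreeGroup.lift_mk]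
      cases b <;> by_cases h : i = j <;> simp [h]
    simp only [this]
    cases b <;> simp

/-- The sum over cyclically reduced words, normalised, is a function of `∑ cos θ_j`. -/
theorem cyclicWordSum_phase (hk : 2 ≤ k) {n : ℕ} (hn : 0 < n) (θ : Fin k → ℝ) :
    cyclicWordSum n (phase θ) = (2 * k - 1) ^ n * charFn k n (∑ i, Real.cos (θ i)) := by
  obtain ⟨m, rfl⟩ := Nat.exists_eq_add_one_of_ne_zero hn.ne'
  have hq := card_letters_sub_one_ne_zero hk
  rw [← trace_transferMatrix_pow, trace_transferMatrix_pow_eq (phase_mul θ)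
    (x := (2 * k - 1) * rootPlus k (∑ i, Real.cos (θ i)))
    (y := (2 * k - 1) * rootMinus k (∑ i, Real.cos (θ i)))
    (by rw [rootPlus_add_rootMinus hk, sum_phase]) (rootPlus_mul_rootMinus hk _), charFn,
    mul_pow, mul_pow, mul_add ((2 * k - 1 : ℂ) ^ _), mul_add ((2 * k - 1 : ℂ) ^ _),
    mul_div_cancel₀ _ (pow_ne_zero _ hq)]

/-- A fundamental domain for the dual torus. -/
def torusBox (k : ℕ) : Set (Fin k → ℝ) := Set.univ.pi fun _ => Set.Ioc (-Real.pi) Real.pi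

theorem measurableSet_torusBox (k : ℕ) : MeasurableSet (torusBox k) :=
  MeasurableSet.univ_pi fun _ => measurableSet_Ioc

theorem setIntegral_torusBox_prod {𝕜 : Type*} [RCLike 𝕜] (f : Fin k → ℝ → 𝕜) :
    ∫ θ in torusBox k, ∏ j, f j (θ j) = ∏ j, ∫ x in Set.Ioc (-Real.pi) Real.pi, f j x := by
  rw [torusBox, volume_pi, Measure.restrict_pi_pi, integral_fintype_prod_eq_prod f]

/-- Orthogonality of the characters of the torus. -/
theorem setIntegral_torusBox_exp (γ : Fin k → ℤ) :
    ∫ θ in torusBox k, Complex.exp ((∑ j, θ j * γ j : ℝ) * I) =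
      if γ = 0 then ((2 * Real.pi) ^ k : ℂ) else 0 := by
  have h1 : ∀ m : ℤ, ∫ x in Set.Ioc (-Real.pi) Real.pi, Complex.exp ((x * m : ℝ) * I) =
      if m = 0 then (2 * Real.pi : ℂ) else 0 := by
    intro m
    rw [← intervalIntegral.integral_of_le (by linarith [Real.pi_pos])]
    split_ifs with hm
    · subst hm
      simp
      ring
    · have hc : (m * I : ℂ) ≠ 0 := by simp [hm]
      have h2 : ∀ x : ℝ, Complex.exp ((x * m : ℝ) * I) = Complex.exp ((m * I) * x) := by
        intro x
        push_cast
        congr 1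
        ring
      simp_rw [h2]
      rw [integral_exp_mul_complex hc]
      rw [div_eq_zero_iff]
      left
      rw [sub_eq_zero, Complex.exp_eq_exp_iff_exists_int]
      refine ⟨m, ?_⟩
      push_cast
      ring
  have h2 : ∀ θ : Fin k → ℝ, Complex.exp ((∑ j, θ j * γ j : ℝ) * I) =
      ∏ j, Complex.exp ((θ j * γ j : ℝ) * I) := by
    intro θ
    rw [← Complex.exp_sum]
    push_cast
    rw [Finset.sum_mul]
  simp_rw [h2]
  rw [setIntegral_torusBox_prod fun j (x : ℝ) => Complex.exp ((x * γ j : ℝ) * I)]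
  simp_rw [h1]
  split_ifs with hγ
  · simp [hγ]
  · obtain ⟨j, hj⟩ := Function.ne_iff.1 hγ
    exact Finset.prod_eq_zero (Finset.mem_univ j) (by simpa using hj)

theorem integrableOn_torusBox {f : (Fin k → ℝ) → ℂ} (hf : Continuous f) :
    IntegrableOn f (torusBox k) := by
  refine (hf.continuousOn.integrableOn_compact
    (isCompact_univ_pi fun _ => isCompact_Icc (a := -Real.pi) (b := Real.pi))).mono_set ?_
  exact Set.pi_mono fun _ _ => Set.Ioc_subset_Icc_self

/-- The number of cyclically reduced words with image `β`, as a Fourier coefficient. -/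
theorem setIntegral_exp_mul_cyclicWordSum (β : Fin k → ℤ) (n : ℕ) :
    ∫ θ in torusBox k, Complex.exp (-(∑ j, θ j * β j : ℝ) * I) * cyclicWordSum n (phase θ) =
      (2 * Real.pi) ^ k * (cyclicWords {β} n).ncard := by
  classical
  have h1 : ∀ θ : Fin k → ℝ,
      Complex.exp (-(∑ j, θ j * β j : ℝ) * I) * cyclicWordSum n (phase θ) =
      ∑ L ∈ (cyclicWords_finite (Set.univ : Set (Fin k → ℤ)) n).toFinset,
        Complex.exp ((∑ j, θ j * (logVector (FreeGroup.mk L) - β) j : ℝ) * I) := by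
    intro θ
    rw [cyclicWordSum, Finset.mul_sum]
    refine Finset.sum_congr rfl fun L _ => ?_
    rw [prod_phase, ← Complex.exp_add]
    congr 1
    simp only [Pi.sub_apply, Int.cast_sub, mul_sub, Finset.sum_sub_distrib]
    push_cast
    ring
  simp_rw [h1]
  rw [integral_finsetSum]
  · have h2 := fun L : List (Fin k × Bool) =>
      setIntegral_torusBox_exp (logVector (FreeGroup.mk L) - β)
    simp only [h2, sub_eq_zero]
    rw [← Finset.sum_filter, Finset.sum_const, nsmul_eq_mul, mul_comm]
    congr 2
    rw [← Set.ncard_coe_finset]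
    congr 1
    ext L
    simp [cyclicWords, and_assoc]
  · intro L _
    exact integrableOn_torusBox (by fun_prop)

theorem continuous_charFn (k n : ℕ) : Continuous (charFn k n) := by
  have : Continuous (discrRoot k) := by
    unfold discrRoot
    fun_prop
  unfold charFn rootPlus rootMinus
  fun_prop

/-- The mean of the normalised numbers of cyclically reduced words of lengths `n` and `n + 1`
with image `β`. -/
def meanDensity (n : ℕ) (β : Fin k → ℤ) : ℝ :=
  1 / 2 * ((cyclicWords {β} n).ncard / (2 * k - 1) ^ n +
    (cyclicWords {β} (n + 1)).ncard / (2 * k - 1) ^ (n + 1))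

/-- The characteristic function of `meanDensity`. -/
def meanCharFn (k n : ℕ) (θ : Fin k → ℝ) : ℂ :=
  1 / 2 * (charFn k n (∑ i, Real.cos (θ i)) + charFn k (n + 1) (∑ i, Real.cos (θ i)))

theorem continuous_meanCharFn (k n : ℕ) : Continuous (meanCharFn k n) := by
  have h1 := continuous_charFn k n
  have h2 := continuous_charFn k (n + 1)
  unfold meanCharFn
  fun_prop

/-- Fourier inversion for `meanDensity`. -/
theorem setIntegral_exp_mul_meanCharFn (hk : 2 ≤ k) {n : ℕ} (hn : 0 < n) (β : Fin k → ℤ) :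
    ∫ θ in torusBox k, Complex.exp (-(∑ j, θ j * β j : ℝ) * I) * meanCharFn k n θ =
      (2 * Real.pi) ^ k * (meanDensity n β : ℝ) := by
  have hq := card_letters_sub_one_ne_zero hk
  have h : ∀ m, 0 < m → ∫ θ in torusBox k, Complex.exp (-(∑ j, θ j * β j : ℝ) * I) *
      charFn k m (∑ i, Real.cos (θ i)) =
      (2 * Real.pi) ^ k * ((cyclicWords {β} m).ncard / (2 * k - 1) ^ m) := by
    intro m hm
    have h1 := setIntegral_exp_mul_cyclicWordSum β m
    simp_rw [cyclicWordSum_phase hk hm, mul_left_comm _ ((2 * k - 1 : ℂ) ^ m)] at h1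
    rw [integral_const_mul] at h1
    rw [← mul_div_assoc, ← h1, mul_div_cancel_left₀ _ (pow_ne_zero m hq)]
  have hc := fun m => continuous_charFn k m
  have hint : ∀ m, IntegrableOn (fun θ : Fin k → ℝ =>
      Complex.exp (-(∑ j, θ j * β j : ℝ) * I) * charFn k m (∑ i, Real.cos (θ i))) (torusBox k) := by
    intro m
    have := hc m
    exact integrableOn_torusBox (by fun_prop)
  have h2 : ∀ θ : Fin k → ℝ, Complex.exp (-(∑ j, θ j * β j : ℝ) * I) * meanCharFn k n θ =
      1 / 2 * (Complex.exp (-(∑ j, θ j * β j : ℝ) * I) * charFn k n (∑ i, Real.cos (θ i)) +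
      Complex.exp (-(∑ j, θ j * β j : ℝ) * I) * charFn k (n + 1) (∑ i, Real.cos (θ i))) := by
    intro θ
    rw [meanCharFn]
    ring
  simp_rw [h2]
  rw [integral_const_mul, integral_add (hint n) (hint (n + 1)), h n hn, h (n + 1) (by omega),
    meanDensity]
  push_cast
  ring

end FourierInversion

/-! ### The local limit theorem -/

noncomputable section LocalLimit

open MeasureTheory
open Complex (I)

variable {k : ℕ}

/-- The Gaussian weight `t ^ (k / 2) * exp (-π t ‖β‖ ^ 2)` on `ℤ^k`. -/
def gaussianWeight (t : ℝ) (β : Fin k → ℤ) : ℝ :=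
  √t ^ k * Real.exp (-Real.pi * t * ∑ j, (β j : ℝ) ^ 2)

/-- The parameter of the Gaussian weight that approximates the words of length `n`. -/
def gaussianParam (k n : ℕ) : ℝ := (k - 1) / (2 * Real.pi * n)

theorem gaussianParam_pos (hk : 2 ≤ k) {n : ℕ} (hn : 0 < n) : 0 < gaussianParam k n := by
  have hq := card_letters_sub_one_ge hk
  have : (0 : ℝ) < n := by exact_mod_cast hn
  have := Real.pi_pos
  have : (0 : ℝ) < k - 1 := by linarith
  unfold gaussianParam
  positivity

/-- Fourier inversion for the Gaussian weight: it is the transform over all of `ℝ^k` of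
`exp (-n ‖θ‖ ^ 2 / (2 (k - 1)))`. -/
theorem integral_exp_mul_gaussian (hk : 2 ≤ k) {n : ℕ} (hn : 0 < n) (β : Fin k → ℤ) :
    ∫ θ : Fin k → ℝ, Complex.exp (-(∑ j, θ j * β j : ℝ) * I) *
      (Real.exp (-(n / (2 * (k - 1)) * ∑ j, θ j ^ 2)) : ℝ) =
      (2 * Real.pi) ^ k * (gaussianWeight (gaussianParam k n) β : ℝ) := by
  have hq := card_letters_sub_one_ge hk
  have hn' : (0 : ℝ) < n := by exact_mod_cast hn
  have hk1 : (0 : ℝ) < k - 1 := by linarith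
  have hpi := Real.pi_pos
  set b : ℝ := n / (2 * (k - 1)) with hb
  have hb0 : 0 < b := by positivity
  have h1 := GaussianFourier.integral_cexp_neg_sum_mul_add (ι := Fin k) (b := fun _ => (b : ℂ))
    (fun _ => by simpa using hb0) (fun j => -(β j : ℂ) * I)
  have h2 : ∀ θ : Fin k → ℝ, Complex.exp (-∑ j, (b : ℂ) * (θ j : ℂ) ^ 2 +
      ∑ j, -(β j : ℂ) * I * θ j) = Complex.exp (-(∑ j, θ j * β j : ℝ) * I) *
      (Real.exp (-(b * ∑ j, θ j ^ 2)) : ℝ) := by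
    intro θ
    push_cast
    rw [← Complex.exp_add, add_comm]
    congr 1
    rw [Finset.mul_sum, ← Finset.sum_neg_distrib, ← Finset.sum_neg_distrib, Finset.sum_mul]
    congr 1
    exact Finset.sum_congr rfl fun j _ => by ring
  simp_rw [h2] at h1
  rw [h1]
  have h3 : ((Real.pi / b : ℂ)) ^ (1 / 2 : ℂ) = ((2 * Real.pi * √(gaussianParam k n) : ℝ) : ℂ) := by
    rw [← Complex.ofReal_div, show (1 / 2 : ℂ) = ((1 / 2 : ℝ) : ℂ) by push_cast; rfl,
      ← Complex.ofReal_cpow (by positivity), ← Real.sqrt_eq_rpow]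
    congr 1
    rw [← Real.sqrt_sq (by positivity : 0 ≤ 2 * Real.pi), ← Real.sqrt_mul (by positivity)]
    congr 1
    rw [hb, gaussianParam]
    field_simp
  have h4 : ∀ j, Complex.exp ((-(β j : ℂ) * I) ^ 2 / (4 * b)) =
      (Real.exp (-Real.pi * gaussianParam k n * (β j : ℝ) ^ 2) : ℝ) := by
    intro j
    rw [Complex.ofReal_exp]
    congr 1
    have h5 : -Real.pi * gaussianParam k n * (β j : ℝ) ^ 2 = -(β j : ℝ) ^ 2 / (4 * b) := by
      rw [hb, gaussianParam]
      field_simp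
      ring
    rw [h5]
    push_cast
    rw [mul_pow, Complex.I_sq]
    ring
  simp_rw [h3, h4]
  rw [gaussianWeight, Finset.mul_sum, Real.exp_sum, Finset.prod_mul_distrib, Finset.prod_const,
    Finset.card_univ, Fintype.card_fin]
  push_cast
  ring

theorem integrable_exp_neg_mul_sum_sq {b : ℝ} (hb : 0 < b) :
    Integrable fun θ : Fin k → ℝ => Real.exp (-(b * ∑ j, θ j ^ 2)) := by
  have h : (fun θ : Fin k → ℝ => Real.exp (-(b * ∑ j, θ j ^ 2))) =
      fun θ => ∏ j, Real.exp (-b * θ j ^ 2) := by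
    ext θ
    rw [← Real.exp_sum, Finset.mul_sum, ← Finset.sum_neg_distrib]
    congr 1
    exact Finset.sum_congr rfl fun j _ => by ring
  rw [h]
  exact Integrable.fintype_prod (f := fun _ x => Real.exp (-b * x ^ 2))
    fun _ => integrable_exp_neg_mul_sq hb

/-- The `L¹` distance between the characteristic function of the mean density, cut off to the
fundamental domain, and a Gaussian. -/
def charFnError (k n : ℕ) : ℝ :=
  ∫ θ : Fin k → ℝ, ‖(torusBox k).indicator (meanCharFn k n) θ -
    (Real.exp (-(n / (2 * (k - 1)) * ∑ j, θ j ^ 2)) : ℝ)‖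

theorem integrable_charFnError (hk : 2 ≤ k) {n : ℕ} (hn : 0 < n) :
    Integrable fun θ : Fin k → ℝ => (torusBox k).indicator (meanCharFn k n) θ -
    (Real.exp (-(n / (2 * (k - 1)) * ∑ j, θ j ^ 2)) : ℝ) := by
  have hq := card_letters_sub_one_ge hk
  have hn' : (0 : ℝ) < n := by exact_mod_cast hn
  have hk1 : (0 : ℝ) < k - 1 := by linarith
  refine Integrable.sub ?_ (integrable_exp_neg_mul_sum_sq (by positivity)).ofReal
  exact (integrable_indicator_iff (measurableSet_torusBox k)).2
    (integrableOn_torusBox (continuous_meanCharFn k n))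

/-- The distance between the mean density and the Gaussian weight is bounded, uniformly in `β`,
by the `L¹` distance between their Fourier transforms. -/
theorem abs_meanDensity_sub_le (hk : 2 ≤ k) {n : ℕ} (hn : 0 < n) (β : Fin k → ℤ) :
    |meanDensity n β - gaussianWeight (gaussianParam k n) β| ≤
      ((2 * Real.pi) ^ k)⁻¹ * charFnError k n := by
  have hpi := Real.pi_pos
  have hq := card_letters_sub_one_ge hk
  have hn' : (0 : ℝ) < n := by exact_mod_cast hn
  have hk1 : (0 : ℝ) < k - 1 := by linarith
  have h1 := setIntegral_exp_mul_meanCharFn hk hn β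
  have h2 := integral_exp_mul_gaussian hk hn β
  rw [← integral_indicator (measurableSet_torusBox k)] at h1
  have hphase : ∀ θ : Fin k → ℝ, ‖Complex.exp (-(∑ j, θ j * β j : ℝ) * I)‖ = 1 := by
    intro θ
    rw [← Complex.ofReal_neg, Complex.norm_exp_ofReal_mul_I]
  have hcont : Continuous fun θ : Fin k → ℝ => Complex.exp (-(∑ j, θ j * β j : ℝ) * I) := by
    fun_prop
  have hi1 : Integrable ((torusBox k).indicator fun θ : Fin k → ℝ =>
      Complex.exp (-(∑ j, θ j * β j : ℝ) * I) * meanCharFn k n θ) :=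
    (integrable_indicator_iff (measurableSet_torusBox k)).2
      (integrableOn_torusBox (hcont.mul (continuous_meanCharFn k n)))
  have hi2 : Integrable fun θ : Fin k → ℝ => Complex.exp (-(∑ j, θ j * β j : ℝ) * I) *
      (Real.exp (-(n / (2 * (k - 1)) * ∑ j, θ j ^ 2)) : ℝ) := by
    refine Integrable.bdd_mul (c := 1)
      (integrable_exp_neg_mul_sum_sq (by positivity)).ofReal hcont.aestronglyMeasurable ?_
    exact ae_of_all _ fun θ => (hphase θ).le
  have h3 : (2 * Real.pi) ^ k * |meanDensity n β - gaussianWeight (gaussianParam k n) β| ≤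
      charFnError k n := by
    have h4 : ((2 * Real.pi) ^ k * |meanDensity n β - gaussianWeight (gaussianParam k n) β| : ℝ) =
        ‖((2 * Real.pi) ^ k * (meanDensity n β : ℝ) -
          (2 * Real.pi) ^ k * (gaussianWeight (gaussianParam k n) β : ℝ) : ℂ)‖ := by
      rw [← mul_sub, norm_mul, ← Complex.ofReal_sub, Complex.norm_real, Real.norm_eq_abs]
      congr 1
      rw [norm_pow, norm_mul, Complex.norm_real, Real.norm_eq_abs, abs_of_pos hpi]
      simp
    rw [h4, ← h1, ← h2, ← integral_sub hi1 hi2]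
    refine (norm_integral_le_integral_norm _).trans (le_of_eq ?_)
    refine integral_congr_ae (ae_of_all _ fun θ => ?_)
    by_cases hθ : θ ∈ torusBox k
    · simp only [Set.indicator_of_mem hθ]
      rw [← mul_sub, norm_mul, hphase, one_mul]
    · simp only [Set.indicator_of_notMem hθ, zero_sub, norm_neg]
      rw [norm_mul, hphase, one_mul]
  rw [inv_mul_eq_div, le_div_iff₀ (by positivity), mul_comm]
  exact h3

theorem sum_cos_bounds (θ : Fin k → ℝ) : |∑ i, Real.cos (θ i)| ≤ k := by
  refine (Finset.abs_sum_le_sum_abs _ _).trans ?_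
  refine (Finset.sum_le_card_nsmul _ _ 1 fun i _ => Real.abs_cos_le_one _).trans ?_
  simp

theorem sum_cos_le_of_mem {θ : Fin k → ℝ} (hθ : θ ∈ torusBox k) :
    2 / Real.pi ^ 2 * ∑ j, θ j ^ 2 ≤ k - ∑ i, Real.cos (θ i) := by
  have h1 : ∀ i, 2 / Real.pi ^ 2 * θ i ^ 2 ≤ 1 - Real.cos (θ i) := by
    intro i
    have hi := hθ i (Set.mem_univ i)
    have h2 := Real.cos_le_one_sub_mul_cos_sq (x := θ i) (abs_le.2 ⟨hi.1.le, hi.2⟩)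
    linarith
  rw [Finset.mul_sum]
  refine (Finset.sum_le_sum fun i _ => h1 i).trans (le_of_eq ?_)
  rw [Finset.sum_sub_distrib]
  simp

/-- The part of the fundamental domain away from the second peak `(π, …, π)`. -/
def mainRegion (k : ℕ) : Set (Fin k → ℝ) := torusBox k ∩ {θ | 0 ≤ ∑ i, Real.cos (θ i)}

theorem measurableSet_mainRegion (k : ℕ) : MeasurableSet (mainRegion k) := by
  refine (measurableSet_torusBox k).inter ?_
  exact (isClosed_le continuous_const (by fun_prop)).measurableSet

/-- A Gaussian bound on the main region, which after rescaling `θ` by `√n` does not depend on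
`n`. -/
theorem norm_meanCharFn_le_of_mem (hk : 2 ≤ k) (n : ℕ) {θ : Fin k → ℝ} (hθ : θ ∈ mainRegion k) :
    ‖meanCharFn k n θ‖ ≤ 2 * k * Real.exp (-(n / (Real.pi ^ 2 * k) * ∑ j, θ j ^ 2)) := by
  have hpi := Real.pi_pos
  have hq := card_letters_sub_one_ge hk
  have hk1 : (0 : ℝ) < k := by linarith
  obtain ⟨hbox, h0⟩ := hθ
  have h0 : 0 ≤ ∑ i, Real.cos (θ i) := h0
  have h1 := sum_cos_bounds θ
  have h2 := sum_cos_le_of_mem hbox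
  have hle : ∀ m : ℕ, n ≤ m → ‖charFn k m (∑ i, Real.cos (θ i))‖ ≤
      2 * k * Real.exp (-(n / (Real.pi ^ 2 * k) * ∑ j, θ j ^ 2)) := by
    intro m hm
    refine (norm_charFn_le hk m h1).trans ?_
    have hm' : (n : ℝ) ≤ m := by exact_mod_cast hm
    rw [abs_of_nonneg h0]
    gcongr
    rw [div_mul_eq_mul_div, div_le_div_iff₀ (by positivity) (by positivity)]
    have h3 : 2 * ∑ j, θ j ^ 2 ≤ (k - ∑ i, Real.cos (θ i)) * Real.pi ^ 2 := by
      rw [div_mul_eq_mul_div, div_le_iff₀ (by positivity)] at h2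
      exact h2
    have h4 : 0 ≤ k - ∑ i, Real.cos (θ i) := by
      have := (abs_le.1 h1).2
      linarith
    calc (n * ∑ j, θ j ^ 2) * (2 * k) = n * (2 * ∑ j, θ j ^ 2) * k := by ring
      _ ≤ m * ((k - ∑ i, Real.cos (θ i)) * Real.pi ^ 2) * k := by
          gcongr
      _ = _ := by ring
  rw [meanCharFn, norm_mul]
  have := norm_add_le (charFn k n (∑ i, Real.cos (θ i))) (charFn k (n + 1) (∑ i, Real.cos (θ i)))
  have h5 := hle n le_rfl
  have h6 := hle (n + 1) (by omega)
  norm_num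
  linarith

/-- The bound around the second peak `(π, …, π)`, with the factor `1 / n` that comes from averaging
over two consecutive lengths. -/
theorem norm_meanCharFn_le_of_sum_cos_nonpos (hk : 2 ≤ k) {n : ℕ} (hn : 0 < n) {θ : Fin k → ℝ}
    (hθ : ∑ i, Real.cos (θ i) ≤ 0) :
    ‖meanCharFn k n θ‖ ≤ 8 * k / n * ∏ j, Real.exp (-(n / (4 * k) * (1 + Real.cos (θ j)))) := by
  have h1 := norm_charFn_add_succ_le hk hn (sum_cos_bounds θ) hθ
  have h2 : ∏ j, Real.exp (-(n / (4 * k) * (1 + Real.cos (θ j)))) =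
      Real.exp (-(n * (k + ∑ i, Real.cos (θ i)) / (4 * k))) := by
    rw [← Real.exp_sum, Finset.sum_neg_distrib, ← Finset.mul_sum, Finset.sum_add_distrib]
    congr 1
    simp
    ring
  rw [h2, meanCharFn, norm_mul]
  norm_num
  calc _ ≤ 1 / 2 * (16 * k / n * Real.exp (-(n * (k + ∑ i, Real.cos (θ i)) / (4 * k)))) := by
        gcongr
    _ = _ := by ring

/-- The integrand is periodic, so that a shift by `π` moves its peak to `0`, where it is below a
Gaussian. -/
theorem integral_exp_neg_one_add_cos_le {a : ℝ} (ha : 0 < a) :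
    ∫ x in Set.Ioc (-Real.pi) Real.pi, Real.exp (-(a * (1 + Real.cos x))) ≤
      √(Real.pi ^ 3 / (2 * a)) := by
  have hpi := Real.pi_pos
  rw [← intervalIntegral.integral_of_le (by linarith)]
  set h : ℝ → ℝ := fun x => Real.exp (-(a * (1 + Real.cos x))) with hh
  have hper : Function.Periodic h (2 * Real.pi) := fun x => by simp [hh]
  have h1 : ∫ x in (-Real.pi)..Real.pi, h x = ∫ x in (-Real.pi)..Real.pi, h (x + Real.pi) := by
    rw [intervalIntegral.integral_comp_add_right]
    have := hper.intervalIntegral_add_eq (-Real.pi) 0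
    rw [show -Real.pi + 2 * Real.pi = Real.pi by ring] at this
    rw [this]
    congr 1 <;> ring
  rw [h1, intervalIntegral.integral_of_le (by linarith)]
  have h2 : √(Real.pi ^ 3 / (2 * a)) = ∫ x : ℝ, Real.exp (-(2 * a / Real.pi ^ 2) * x ^ 2) := by
    rw [integral_gaussian]
    congr 1
    field_simp
  rw [h2]
  have hint : Integrable fun x : ℝ => Real.exp (-(2 * a / Real.pi ^ 2) * x ^ 2) :=
    integrable_exp_neg_mul_sq (by positivity)
  refine (setIntegral_mono_on ?_ hint.integrableOn measurableSet_Ioc ?_).trans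
    (setIntegral_le_integral hint (ae_of_all _ fun x => (Real.exp_pos _).le))
  · refine (Continuous.integrableOn_Icc ?_).mono_set Set.Ioc_subset_Icc_self
    simp only [hh]
    fun_prop
  · intro x hx
    have h3 := Real.cos_le_one_sub_mul_cos_sq (x := x) (abs_le.2 ⟨hx.1.le, hx.2⟩)
    simp only [hh, Real.cos_add_pi]
    rw [Real.exp_le_exp]
    have h4 : a * (2 / Real.pi ^ 2 * x ^ 2) ≤ a * (1 - Real.cos x) := by
      gcongr
      linarith
    calc -(a * (1 + -Real.cos x)) ≤ -(a * (2 / Real.pi ^ 2 * x ^ 2)) := by linarith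
      _ = _ := by ring

theorem tendsto_nat_mul_one_sub_cos (x : ℝ) :
    Tendsto (fun n : ℕ => n * (1 - Real.cos (x / √n))) atTop (𝓝 (x ^ 2 / 2)) := by
  have h1 : Tendsto (fun n : ℕ => x / √n / 2) atTop (𝓝 0) := by
    have h : Tendsto (fun n : ℕ => √(n : ℝ)) atTop atTop :=
      Real.tendsto_sqrt_atTop.comp tendsto_natCast_atTop_atTop
    simpa using (h.const_div_atTop x).div_const 2
  have h2 : Tendsto (fun n : ℕ => x ^ 2 / 2 * Real.sinc (x / √n / 2) ^ 2) atTop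
      (𝓝 (x ^ 2 / 2)) := by
    have := (((Real.continuous_sinc.tendsto 0).comp h1).pow 2).const_mul (x ^ 2 / 2)
    simpa using this
  refine h2.congr' ?_
  filter_upwards [eventually_gt_atTop 0] with n hn
  have hn' : (0 : ℝ) < n := by exact_mod_cast hn
  have hs : √(n : ℝ) ^ 2 = n := Real.sq_sqrt hn'.le
  have hs0 : √(n : ℝ) ≠ 0 := (Real.sqrt_pos.2 hn').ne'
  have h3 : Real.cos (x / √n) = 1 - 2 * Real.sin (x / √n / 2) ^ 2 := by
    have h5 := Real.cos_sq_add_sin_sq (x / √n / 2)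
    have h4 := Real.cos_two_mul (x / √n / 2)
    rw [mul_div_cancel₀ _ two_ne_zero] at h4
    rw [h4]
    linarith
  rw [h3]
  rcases eq_or_ne x 0 with rfl | hx
  · simp
  · rw [Real.sinc_of_ne_zero (by positivity)]
    have h6 : (n : ℝ) = √(n : ℝ) ^ 2 := hs.symm
    rw [h6, Real.sqrt_sq (Real.sqrt_nonneg _)]
    field_simp
    ring

theorem tendsto_meanCharFn_div_sqrt (hk : 2 ≤ k) (ξ : Fin k → ℝ) :
    Tendsto (fun n : ℕ => meanCharFn k n ((√(n : ℝ))⁻¹ • ξ)) atTop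
      (𝓝 (Real.exp (-(1 / (2 * (k - 1)) * ∑ j, ξ j ^ 2)) : ℝ)) := by
  have hq := card_letters_sub_one_ge hk
  have hk1 : (k - 1 : ℝ) ≠ 0 := by linarith
  have h1 : Tendsto (fun n : ℕ => n * (k - ∑ i, Real.cos (((√(n : ℝ))⁻¹ • ξ) i))) atTop
      (𝓝 (∑ i, ξ i ^ 2 / 2)) := by
    have h2 := tendsto_finsetSum Finset.univ fun i (_ : i ∈ Finset.univ) =>
      tendsto_nat_mul_one_sub_cos (ξ i)
    refine h2.congr fun n => ?_
    rw [← Finset.mul_sum, Finset.sum_sub_distrib]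
    simp [div_eq_inv_mul]
  obtain ⟨h3, h4⟩ := tendsto_charFn hk (fun n => sum_cos_bounds _) h1
  have h5 := (h3.add h4).const_mul (1 / 2 : ℂ)
  have h6 : -(∑ i, ξ i ^ 2 / 2) / (k - 1) = -(1 / (2 * (k - 1)) * ∑ j, ξ j ^ 2) := by
    rw [← Finset.sum_div]
    field_simp
  rw [h6, ← mul_two, mul_comm _ (2 : ℂ), ← mul_assoc, one_div_mul_cancel two_ne_zero, one_mul] at h5
  exact h5

theorem eventually_mem_mainRegion (hk : 2 ≤ k) (ξ : Fin k → ℝ) :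
    ∀ᶠ n : ℕ in atTop, (√(n : ℝ))⁻¹ • ξ ∈ mainRegion k := by
  have hq := card_letters_sub_one_ge hk
  have h0 : Tendsto (fun n : ℕ => (√(n : ℝ))⁻¹ • ξ) atTop (𝓝 0) := by
    have h : Tendsto (fun n : ℕ => √(n : ℝ)) atTop atTop :=
      Real.tendsto_sqrt_atTop.comp tendsto_natCast_atTop_atTop
    simpa using h.inv_tendsto_atTop.smul_const ξ
  refine h0.eventually (Filter.inter_mem ?_ ?_)
  · refine set_pi_mem_nhds Set.finite_univ fun i _ => ?_
    exact Ioc_mem_nhds (by simp [Real.pi_pos]) (by simp [Real.pi_pos])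
  · have hc : Continuous fun θ : Fin k → ℝ => ∑ i, Real.cos (θ i) := by fun_prop
    have : (0 : ℝ) < ∑ i : Fin k, Real.cos ((0 : Fin k → ℝ) i) := by
      simp
      omega
    exact ((hc.tendsto 0).eventually_const_lt this).mono fun θ hθ => hθ.le

/-- On the main region the error is negligible by dominated convergence, after the substitution
`θ = ξ / √n`. -/
theorem tendsto_mainRegion_error (hk : 2 ≤ k) :
    Tendsto (fun n : ℕ => √(n : ℝ) ^ k * ∫ θ : Fin k → ℝ,
      ‖(mainRegion k).indicator (meanCharFn k n) θ -
        (Real.exp (-(n / (2 * (k - 1)) * ∑ j, θ j ^ 2)) : ℝ)‖) atTop (𝓝 0) := by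
  have hpi := Real.pi_pos
  have hq := card_letters_sub_one_ge hk
  have hk1 : (0 : ℝ) < k - 1 := by linarith
  have hk0 : (0 : ℝ) < k := by linarith
  set F : ℕ → (Fin k → ℝ) → ℝ := fun n θ => ‖(mainRegion k).indicator (meanCharFn k n) θ -
        (Real.exp (-(n / (2 * (k - 1)) * ∑ j, θ j ^ 2)) : ℝ)‖ with hF
  have hscale : ∀ n : ℕ, √(n : ℝ) ^ k * ∫ θ, F n θ = ∫ ξ, F n ((√(n : ℝ))⁻¹ • ξ) := by
    intro n
    rw [Measure.integral_comp_inv_smul_of_nonneg _ _ (Real.sqrt_nonneg _)]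
    simp
  have hsq : ∀ n : ℕ, 0 < n → ∀ ξ : Fin k → ℝ,
      (n : ℝ) * ∑ j, ((√(n : ℝ))⁻¹ • ξ) j ^ 2 = ∑ j, ξ j ^ 2 := by
    intro n hn ξ
    have hn' : (0 : ℝ) < n := by exact_mod_cast hn
    simp only [Pi.smul_apply, smul_eq_mul, mul_pow, inv_pow, Real.sq_sqrt hn'.le]
    rw [← Finset.mul_sum, mul_inv_cancel_left₀ hn'.ne']
  have hgauss : ∀ n : ℕ, 0 < n → ∀ (c : ℝ) (ξ : Fin k → ℝ),
      Real.exp (-(n / c * ∑ j, ((√(n : ℝ))⁻¹ • ξ) j ^ 2)) =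
      Real.exp (-(1 / c * ∑ j, ξ j ^ 2)) := by
    intro n hn c ξ
    rw [← hsq n hn ξ]
    congr 1
    ring
  refine Tendsto.congr (fun n => (hscale n).symm) ?_
  rw [← integral_zero (Fin k → ℝ) ℝ (μ := volume)]
  refine tendsto_integral_filter_of_dominated_convergence
    (fun ξ => 2 * k * Real.exp (-(1 / (Real.pi ^ 2 * k) * ∑ j, ξ j ^ 2)) +
      Real.exp (-(1 / (2 * (k - 1)) * ∑ j, ξ j ^ 2))) ?_ ?_ ?_ ?_
  · refine Eventually.of_forall fun n => ?_
    have h1 : Measurable (F n) := by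
      refine Measurable.norm (Measurable.sub ?_ ?_)
      · exact (continuous_meanCharFn k n).measurable.indicator (measurableSet_mainRegion k)
      · exact Complex.measurable_ofReal.comp (by fun_prop)
    exact (h1.comp (measurable_const_smul _)).aestronglyMeasurable
  · filter_upwards [eventually_gt_atTop 0] with n hn
    refine ae_of_all _ fun ξ => ?_
    simp only [hF]
    rw [norm_norm]
    refine (norm_sub_le _ _).trans (add_le_add ?_ ?_)
    · by_cases h : (√(n : ℝ))⁻¹ • ξ ∈ mainRegion k
      · rw [Set.indicator_of_mem h, ← hgauss n hn]
        exact norm_meanCharFn_le_of_mem hk n h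
      · rw [Set.indicator_of_notMem h, norm_zero]
        positivity
    · rw [Complex.norm_real, Real.norm_eq_abs, abs_of_pos (Real.exp_pos _), hgauss n hn]
  · refine Integrable.add (Integrable.const_mul ?_ _) ?_
    · exact integrable_exp_neg_mul_sum_sq (by positivity)
    · exact integrable_exp_neg_mul_sum_sq (by positivity)
  · refine ae_of_all _ fun ξ => ?_
    have h1 := (tendsto_meanCharFn_div_sqrt hk ξ).sub_const
      ((Real.exp (-(1 / (2 * (k - 1)) * ∑ j, ξ j ^ 2)) : ℝ) : ℂ)
    rw [sub_self] at h1
    have h2 := h1.norm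
    rw [norm_zero] at h2
    refine h2.congr' ?_
    filter_upwards [eventually_mem_mainRegion hk ξ, eventually_gt_atTop 0] with n hn hn0
    simp only [hF]
    rw [Set.indicator_of_mem hn, hgauss n hn0]

/-- The second peak has the same width `1 / √n` as the first one, but its height is only of order
`1 / n`. -/
theorem integral_diff_mainRegion_le (hk : 2 ≤ k) {n : ℕ} (hn : 0 < n) :
    √(n : ℝ) ^ k * ∫ θ : Fin k → ℝ,
      ‖(torusBox k \ mainRegion k).indicator (meanCharFn k n) θ‖ ≤
    8 * k / n * √(2 * Real.pi ^ 3 * k) ^ k := by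
  have hpi := Real.pi_pos
  have hq := card_letters_sub_one_ge hk
  have hk0 : (0 : ℝ) < k := by linarith
  have hn' : (0 : ℝ) < n := by exact_mod_cast hn
  set G : (Fin k → ℝ) → ℝ :=
    fun θ => ∏ j, Real.exp (-(n / (4 * k) * (1 + Real.cos (θ j)))) with hG
  have hGc : Continuous G := by fun_prop
  have hGint : IntegrableOn G (torusBox k) := by
    refine (hGc.continuousOn.integrableOn_compact
      (isCompact_univ_pi fun _ => isCompact_Icc (a := -Real.pi) (b := Real.pi))).mono_set ?_
    exact Set.pi_mono fun _ _ => Set.Ioc_subset_Icc_self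
  have hmeas := measurableSet_torusBox k
  have h1 : ∫ θ : Fin k → ℝ, ‖(torusBox k \ mainRegion k).indicator (meanCharFn k n) θ‖ ≤
      ∫ θ in torusBox k, 8 * k / n * G θ := by
    rw [← integral_indicator hmeas]
    refine integral_mono_of_nonneg (ae_of_all _ fun _ => norm_nonneg _)
      ((integrable_indicator_iff hmeas).2 (hGint.const_mul _)) (ae_of_all _ fun θ => ?_)
    by_cases h : θ ∈ torusBox k \ mainRegion k
    · simp only [Set.indicator_of_mem h, Set.indicator_of_mem h.1]
      refine norm_meanCharFn_le_of_sum_cos_nonpos hk hn ?_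
      by_contra hcon
      exact h.2 ⟨h.1, (not_le.1 hcon).le⟩
    · simp only [Set.indicator_of_notMem h, norm_zero]
      exact Set.indicator_nonneg (fun θ _ => by positivity) θ
  have h2 : ∫ θ in torusBox k, 8 * k / n * G θ ≤ 8 * k / n * √(2 * Real.pi ^ 3 * k / n) ^ k := by
    rw [integral_const_mul, hG,
      setIntegral_torusBox_prod fun _ x => Real.exp (-(n / (4 * k) * (1 + Real.cos x))),
      Finset.prod_const, Finset.card_univ, Fintype.card_fin]
    have h3 := integral_exp_neg_one_add_cos_le (a := n / (4 * k)) (by positivity)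
    have h4 : Real.pi ^ 3 / (2 * (n / (4 * k))) = 2 * Real.pi ^ 3 * k / n := by
      field_simp
      norm_num
    rw [h4] at h3
    have h5 : 0 ≤ ∫ x in Set.Ioc (-Real.pi) Real.pi,
        Real.exp (-(n / (4 * k) * (1 + Real.cos x))) :=
      integral_nonneg fun x => (Real.exp_pos _).le
    gcongr
  calc _ ≤ √(n : ℝ) ^ k * (8 * k / n * √(2 * Real.pi ^ 3 * k / n) ^ k) := by
        gcongr
        exact h1.trans h2
    _ = 8 * k / n * (√(n : ℝ) * √(2 * Real.pi ^ 3 * k / n)) ^ k := by ring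
    _ = _ := by
        rw [← Real.sqrt_mul hn'.le, mul_div_cancel₀ _ hn'.ne']

/-- The error term of the local limit theorem is of smaller order than the main term. -/
theorem tendsto_charFnError (hk : 2 ≤ k) :
    Tendsto (fun n : ℕ => √(n : ℝ) ^ k * charFnError k n) atTop (𝓝 0) := by
  have hq := card_letters_sub_one_ge hk
  have hk1 : (0 : ℝ) < k - 1 := by linarith
  have h1 : Tendsto (fun n : ℕ => 8 * k / n * √(2 * Real.pi ^ 3 * k) ^ k) atTop (𝓝 0) := by
    have := (tendsto_const_div_atTop_nhds_zero_nat (8 * k : ℝ)).mul_const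
      (√(2 * Real.pi ^ 3 * k) ^ k)
    simpa using this
  have h2 := (tendsto_mainRegion_error hk).add h1
  rw [add_zero] at h2
  refine squeeze_zero' (Eventually.of_forall fun n => ?_) ?_ h2
  · exact mul_nonneg (by positivity) (integral_nonneg fun _ => norm_nonneg _)
  · filter_upwards [eventually_gt_atTop 0] with n hn
    have hn' : (0 : ℝ) < n := by exact_mod_cast hn
    refine le_trans ?_ (add_le_add le_rfl (integral_diff_mainRegion_le hk hn))
    rw [← mul_add]
    refine mul_le_mul_of_nonneg_left ?_ (by positivity)
    have hint : ∀ s ⊆ torusBox k, MeasurableSet s →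
        Integrable (s.indicator (meanCharFn k n)) := fun s hs hm =>
      (integrable_indicator_iff hm).2
        ((integrableOn_torusBox (continuous_meanCharFn k n)).mono_set hs)
    have hi1 : Integrable fun θ : Fin k → ℝ => ‖(mainRegion k).indicator (meanCharFn k n) θ -
        (Real.exp (-(n / (2 * (k - 1)) * ∑ j, θ j ^ 2)) : ℝ)‖ :=
      ((hint _ Set.inter_subset_left (measurableSet_mainRegion k)).sub
        (integrable_exp_neg_mul_sum_sq (by positivity)).ofReal).norm
    have hi2 := (hint _ Set.sdiff_subset
      ((measurableSet_torusBox k).diff (measurableSet_mainRegion k))).norm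
    rw [← integral_add hi1 hi2, charFnError]
    refine integral_mono (integrable_charFnError hk hn).norm (hi1.add hi2) fun θ => ?_
    have h3 : (torusBox k).indicator (meanCharFn k n) θ =
        (mainRegion k).indicator (meanCharFn k n) θ +
        (torusBox k \ mainRegion k).indicator (meanCharFn k n) θ := by
      have h4 := Set.indicator_union_of_disjoint
        (Set.disjoint_sdiff_right (s := mainRegion k) (t := torusBox k)) (meanCharFn k n)
      rw [Set.union_sdiff_cancel (show mainRegion k ⊆ torusBox k from Set.inter_subset_left)] at h4
      rw [h4]
    simp only
    rw [h3, add_sub_right_comm]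
    exact norm_add_le _ _

end LocalLimit

/-! ### Gaussian sums over sets with a density -/

noncomputable section GaussianSums

variable {k : ℕ}

theorem hasSum_ite_le_pow {x : ℝ} (hx0 : 0 ≤ x) (hx1 : x < 1) (m : ℕ) :
    HasSum (fun j => if m ≤ j then x ^ j else 0) (x ^ m / (1 - x)) := by
  have h1 : HasSum (fun i => x ^ (i + m)) (x ^ m / (1 - x)) := by
    have := (hasSum_geometric_of_lt_one hx0 hx1).mul_left (x ^ m)
    simpa [pow_add, mul_comm, div_eq_mul_inv] using this
  have hinj : Function.Injective fun i : ℕ => i + m := add_left_injective m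
  rw [← hinj.hasSum_iff]
  · convert! h1 using 2 with i
    simp
  · intro j hj
    rw [if_neg]
    intro h
    exact hj ⟨j - m, by simp; omega⟩

/-- Abel summation for a family graded by `m`: its generating function is a mixture, with
geometric weights, of the sums over the sublevel sets of `m`. -/
theorem tsum_mul_pow_eq {ι : Type*} {m : ι → ℕ} (hfin : ∀ j, {i | m i ≤ j}.Finite) {c : ι → ℝ}
    {M : ℝ} (hc : ∀ i, |c i| ≤ M) {x : ℝ} (hx0 : 0 ≤ x) (hx1 : x < 1)
    (hs : Summable fun i => x ^ m i) :
    Summable (fun j => (∑ i ∈ (hfin j).toFinset, c i) * x ^ j) ∧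
    ∑' i, c i * x ^ m i = (1 - x) * ∑' j, (∑ i ∈ (hfin j).toFinset, c i) * x ^ j := by
  set G : ι × ℕ → ℝ := fun p => if m p.1 ≤ p.2 then x ^ p.2 else 0 with hG
  have hGs : Summable G := by
    rw [summable_prod_of_nonneg]
    · constructor
      · intro i
        exact (hasSum_ite_le_pow hx0 hx1 (m i)).summable
      · have : (fun i => ∑' j, G (i, j)) = fun i => x ^ m i / (1 - x) := by
          ext i
          exact (hasSum_ite_le_pow hx0 hx1 (m i)).tsum_eq
        rw [this]
        exact hs.div_const _
    · intro p
      simp only [hG, Pi.zero_apply]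
      split_ifs <;> positivity
  set F : ι × ℕ → ℝ := fun p => c p.1 * G p with hF
  have hFs : Summable F := by
    refine Summable.of_norm_bounded (hGs.mul_left M) fun p => ?_
    have hG0 : 0 ≤ G p := by
      simp only [hG]
      split_ifs <;> positivity
    rw [hF, Real.norm_eq_abs, abs_mul, abs_of_nonneg hG0]
    exact mul_le_mul_of_nonneg_right (hc p.1) hG0
  have hcol : ∀ j, ∑' i, F (i, j) = (∑ i ∈ (hfin j).toFinset, c i) * x ^ j := by
    intro j
    rw [tsum_eq_sum (s := (hfin j).toFinset), Finset.sum_mul]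
    · refine Finset.sum_congr rfl fun i hi => ?_
      have : m i ≤ j := by simpa using hi
      simp [hF, hG, this]
    · intro i hi
      have : ¬ m i ≤ j := by simpa using hi
      simp [hF, hG, this]
  have hrow : ∀ i, ∑' j, F (i, j) = c i * x ^ m i / (1 - x) := by
    intro i
    rw [mul_div_assoc, ← (hasSum_ite_le_pow hx0 hx1 (m i)).tsum_eq, ← tsum_mul_left]
  constructor
  · simp_rw [← hcol]
    exact ((Equiv.prodComm ℕ ι).summable_iff.2 hFs).prod
  · simp_rw [← hcol]
    have h := hFs.tsum_comm (f := fun i j => F (i, j))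
    simp_rw [hrow] at h
    rw [h, tsum_div_const]
    have : 1 - x ≠ 0 := by linarith
    field_simp

/-- The quantitative Abelian theorem: a bound for the partial sums of a graded family carries
over to its generating function. -/
theorem abs_tsum_mul_pow_le {ι : Type*} {m : ι → ℕ} (hfin : ∀ j, {i | m i ≤ j}.Finite) {c : ι → ℝ}
    {M : ℝ} (hc : ∀ i, |c i| ≤ M) {x : ℝ} (hx0 : 0 ≤ x) (hx1 : x < 1)
    (hs : Summable fun i => x ^ m i) {ε C : ℝ}
    (hbd : ∀ j, |∑ i ∈ (hfin j).toFinset, c i| ≤ ε * (hfin j).toFinset.card + C) :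
    |∑' i, c i * x ^ m i| ≤ ε * ∑' i, x ^ m i + C := by
  obtain ⟨h1, h2⟩ := tsum_mul_pow_eq hfin hc hx0 hx1 hs
  obtain ⟨h3, h4⟩ := tsum_mul_pow_eq hfin (c := fun _ => 1) (M := 1) (by simp) hx0 hx1 hs
  simp only [one_mul, Finset.sum_const, nsmul_eq_mul, mul_one] at h3 h4
  have hgeo := hasSum_geometric_of_lt_one hx0 hx1
  have hx : 0 < 1 - x := by linarith
  have h5 : Summable fun j : ℕ => (ε * (hfin j).toFinset.card + C) * x ^ j := by
    simp_rw [add_mul, mul_assoc]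
    exact (h3.mul_left ε).add (hgeo.summable.mul_left C)
  have h6 : ∑' j : ℕ, (ε * (hfin j).toFinset.card + C) * x ^ j =
      ε * ∑' j : ℕ, (hfin j).toFinset.card * x ^ j + C * (1 - x)⁻¹ := by
    simp_rw [add_mul, mul_assoc]
    rw [(h3.mul_left ε).tsum_add (hgeo.summable.mul_left C), tsum_mul_left, tsum_mul_left,
      hgeo.tsum_eq]
  have h7 : ∀ j : ℕ, |(∑ i ∈ (hfin j).toFinset, c i) * x ^ j| ≤
      (ε * (hfin j).toFinset.card + C) * x ^ j := by
    intro j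
    rw [abs_mul, abs_of_nonneg (pow_nonneg hx0 j)]
    exact mul_le_mul_of_nonneg_right (hbd j) (pow_nonneg hx0 j)
  rw [h2, h4, abs_mul, abs_of_pos hx]
  calc (1 - x) * |∑' j, (∑ i ∈ (hfin j).toFinset, c i) * x ^ j|
      ≤ (1 - x) * ∑' j : ℕ, (ε * (hfin j).toFinset.card + C) * x ^ j := by
        refine mul_le_mul_of_nonneg_left ?_ hx.le
        exact tsum_of_norm_bounded (f := fun j => (∑ i ∈ (hfin j).toFinset, c i) * x ^ j)
          h5.hasSum h7
    _ = _ := by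
        rw [h6]
        field_simp

/-- The square of the Euclidean norm, as a natural number. -/
def normSq (β : Fin k → ℤ) : ℕ := ∑ j, (β j).natAbs ^ 2

theorem cast_normSq (β : Fin k → ℤ) : (normSq β : ℝ) = ∑ j, (β j : ℝ) ^ 2 := by
  rw [normSq]
  push_cast
  refine Finset.sum_congr rfl fun j _ => ?_
  rw [Nat.cast_natAbs]
  push_cast
  exact sq_abs _

theorem latticeNorm_le_sqrt_iff (β : Fin k → ℤ) (j : ℕ) :
    latticeNorm β ≤ √(j : ℝ) ↔ normSq β ≤ j := by
  have h : latticeNorm β = √(normSq β : ℝ) := by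
    rw [latticeNorm, EuclideanSpace.norm_eq, cast_normSq]
    simp
  rw [h, Real.sqrt_le_sqrt_iff (Nat.cast_nonneg j), Nat.cast_le]

theorem normSq_le_subset (j : ℕ) : {β : Fin k → ℤ | normSq β ≤ j} ⊆
    (Fintype.piFinset fun _ => Finset.Icc (-(Nat.sqrt j : ℤ)) (Nat.sqrt j) :
      Finset (Fin k → ℤ)) := by
  intro β hβ
  have hβ : normSq β ≤ j := hβ
  simp only [Finset.mem_coe, Fintype.mem_piFinset, Finset.mem_Icc]
  intro i
  have h1 : (β i).natAbs ^ 2 ≤ j :=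
    (Finset.single_le_sum (f := fun i => (β i).natAbs ^ 2) (fun _ _ => Nat.zero_le _)
      (Finset.mem_univ i)).trans hβ
  have h2 : (β i).natAbs ≤ Nat.sqrt j := Nat.le_sqrt'.2 h1
  omega

theorem normSq_le_finite (j : ℕ) : {β : Fin k → ℤ | normSq β ≤ j}.Finite :=
  (Finset.finite_toSet _).subset (normSq_le_subset j)

theorem card_normSq_le (j : ℕ) :
    (normSq_le_finite (k := k) j).toFinset.card ≤ (2 * Nat.sqrt j + 1) ^ k := by
  refine (Finset.card_le_card (Set.Finite.toFinset_subset.2 (normSq_le_subset j))).trans ?_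
  rw [Fintype.card_piFinset]
  simp only [Int.card_Icc, Finset.prod_const, Finset.card_univ, Fintype.card_fin]
  gcongr
  omega

theorem hasSum_pi_prod {f : ℤ → ℝ} (hf0 : ∀ i, 0 ≤ f i) (hf : Summable f) (k : ℕ) :
    HasSum (fun β : Fin k → ℤ => ∏ j, f (β j)) ((∑' i, f i) ^ k) := by
  induction k with
  | zero =>
    simp [hasSum_unique]
  | succ k ih =>
    rw [← (Fin.consEquiv fun _ => ℤ).hasSum_iff]
    have hs : Summable fun p : ℤ × (Fin k → ℤ) => f p.1 * ∏ j, f (p.2 j) :=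
      Summable.mul_of_nonneg (g := fun β : Fin k → ℤ => ∏ j, f (β j)) hf ih.summable hf0
        fun β => Finset.prod_nonneg fun j _ => hf0 _
    have h := HasSum.mul (f := f) (g := fun β : Fin k → ℤ => ∏ j, f (β j)) hf.hasSum ih hs
    rw [pow_succ']
    refine h.congr_fun ?_
    intro p
    simp [Fin.consEquiv, Fin.prod_univ_succ]

theorem cexp_jacobiTheta_term (t : ℝ) (i : ℤ) :
    Complex.exp (Real.pi * Complex.I * (i : ℂ) ^ 2 * (t * Complex.I)) =
      (Real.exp (-Real.pi * t * (i : ℝ) ^ 2) : ℝ) := by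
  push_cast
  congr 1
  linear_combination (Real.pi * (i : ℂ) ^ 2 * t) * Complex.I_sq

theorem summable_exp_neg_mul_int_sq {t : ℝ} (ht : 0 < t) :
    Summable fun i : ℤ => Real.exp (-Real.pi * t * (i : ℝ) ^ 2) := by
  have h := ((summable_jacobiTheta₂_term_iff 0 (t * Complex.I)).2 (by simpa using ht))
  rw [← Complex.summable_ofReal]
  refine h.congr fun i => ?_
  rw [← cexp_jacobiTheta_term, jacobiTheta₂_term]
  congr 1
  ring

/-- A theta function is close to `1` for large `t`. -/
theorem abs_tsum_exp_sub_one_le {t : ℝ} (ht : 0 < t) :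
    |∑' i : ℤ, Real.exp (-Real.pi * t * (i : ℝ) ^ 2) - 1| ≤
      2 / (1 - Real.exp (-Real.pi * t)) * Real.exp (-Real.pi * t) := by
  have h := norm_jacobiTheta_sub_one_le (τ := t * Complex.I) (by simpa using ht)
  have h2 : jacobiTheta (t * Complex.I) =
      (∑' i : ℤ, Real.exp (-Real.pi * t * (i : ℝ) ^ 2) : ℝ) := by
    rw [jacobiTheta, Complex.ofReal_tsum]
    exact tsum_congr fun i => cexp_jacobiTheta_term t i
  rw [h2, ← Complex.ofReal_one, ← Complex.ofReal_sub, Complex.norm_real, Real.norm_eq_abs] at h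
  simpa using h

/-- By Poisson summation, `√t θ(t) = θ(1 / t)`, which tends to `1` as `t → 0`. -/
theorem tendsto_sqrt_mul_tsum_exp : Tendsto
    (fun t : ℝ => √t * ∑' i : ℤ, Real.exp (-Real.pi * t * (i : ℝ) ^ 2)) (𝓝[>] 0) (𝓝 1) := by
  have h1 : Tendsto (fun t : ℝ => -Real.pi * t⁻¹) (𝓝[>] 0) atBot :=
    tendsto_inv_nhdsGT_zero.const_mul_atTop_of_neg (by linarith [Real.pi_pos])
  have h2 := Real.tendsto_exp_atBot.comp h1
  have h3 : Tendsto (fun t : ℝ => 2 / (1 - Real.exp (-Real.pi * t⁻¹)) *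
      Real.exp (-Real.pi * t⁻¹)) (𝓝[>] 0) (𝓝 0) := by
    have := ((tendsto_const_nhds (x := (2 : ℝ))).div (h2.const_sub 1) (by norm_num)).mul h2
    simpa using this
  have h4 : Tendsto (fun t : ℝ => √t * ∑' i : ℤ, Real.exp (-Real.pi * t * (i : ℝ) ^ 2) - 1)
      (𝓝[>] 0) (𝓝 0) := by
    refine squeeze_zero_norm' ?_ h3
    filter_upwards [self_mem_nhdsWithin] with t ht
    have ht : 0 < t := ht
    have h5 := abs_tsum_exp_sub_one_le (inv_pos.2 ht)
    rw [Real.tsum_exp_neg_mul_int_sq ht, ← Real.sqrt_eq_rpow, ← mul_assoc,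
      mul_one_div_cancel (Real.sqrt_pos.2 ht).ne', one_mul, Real.norm_eq_abs]
    exact h5
  simpa using h4.add_const 1

theorem gaussianWeight_eq_pow (t : ℝ) (β : Fin k → ℤ) :
    gaussianWeight t β = √t ^ k * Real.exp (-Real.pi * t) ^ normSq β := by
  rw [gaussianWeight, ← cast_normSq, ← Real.exp_nat_mul, mul_comm _ (normSq β : ℝ)]

theorem hasSum_gaussianWeight {t : ℝ} (ht : 0 < t) :
    HasSum (gaussianWeight (k := k) t)
      ((√t * ∑' i : ℤ, Real.exp (-Real.pi * t * (i : ℝ) ^ 2)) ^ k) := by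
  rw [mul_pow]
  have h := (hasSum_pi_prod (fun i => (Real.exp_pos _).le) (summable_exp_neg_mul_int_sq ht)
    k).mul_left (√t ^ k)
  convert! h using 2 with β
  rw [gaussianWeight, Finset.mul_sum, Real.exp_sum]

theorem gaussianWeight_nonneg (t : ℝ) (β : Fin k → ℤ) : 0 ≤ gaussianWeight t β := by
  unfold gaussianWeight
  positivity

/-- The total mass of the Gaussian weight tends to `1` as it spreads out. -/
theorem tendsto_tsum_gaussianWeight :
    Tendsto (fun t => ∑' β : Fin k → ℤ, gaussianWeight t β) (𝓝[>] 0) (𝓝 1) := by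
  have h := tendsto_sqrt_mul_tsum_exp.pow k
  rw [one_pow] at h
  refine h.congr' ?_
  filter_upwards [self_mem_nhdsWithin] with t ht
  exact (hasSum_gaussianWeight ht).tsum_eq.symm

/-- The density hypothesis along the radii `√j`, in the form required by `abs_tsum_mul_pow_le`; the
constant `C` absorbs the finitely many small radii. -/
theorem exists_partial_sum_bound {B : Set (Fin k → ℤ)} {d : ℝ} (hB : HasAsymptoticDensity B d)
    {ε : ℝ} (hε : 0 < ε) : ∃ C : ℝ, ∀ j : ℕ,
    |∑ β ∈ (normSq_le_finite (k := k) j).toFinset, (B.indicator 1 β - d)| ≤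
      ε * (normSq_le_finite (k := k) j).toFinset.card + C := by
  classical
  have hlim : Tendsto (fun j : ℕ => √(j : ℝ)) atTop atTop :=
    Real.tendsto_sqrt_atTop.comp tendsto_natCast_atTop_atTop
  have h1 := hB.comp hlim
  set S : ℕ → Finset (Fin k → ℤ) := fun j => (normSq_le_finite (k := k) j).toFinset with hS
  have hmem : ∀ j β, β ∈ S j ↔ normSq β ≤ j := by simp [hS]
  have hcard : ∀ j : ℕ, ({β : Fin k → ℤ | latticeNorm β ≤ √(j : ℝ)}.ncard : ℝ) = (S j).card := by
    intro j
    rw [← Set.ncard_coe_finset]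
    congr 2
    ext β
    simp [hmem, latticeNorm_le_sqrt_iff]
  have hcardB : ∀ j : ℕ, ({β : Fin k → ℤ | β ∈ B ∧ latticeNorm β ≤ √(j : ℝ)}.ncard : ℝ) =
      ∑ β ∈ S j, B.indicator 1 β := by
    intro j
    have : {β : Fin k → ℤ | β ∈ B ∧ latticeNorm β ≤ √(j : ℝ)} =
        ((S j).filter (· ∈ B) : Finset _) := by
      ext β
      simp [hmem, latticeNorm_le_sqrt_iff, and_comm]
    rw [this, Set.ncard_coe_finset, Finset.card_filter]
    push_cast
    refine Finset.sum_congr rfl fun β _ => ?_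
    simp [Set.indicator_apply]
  have hpos : ∀ j, 0 < ((S j).card : ℝ) := by
    intro j
    rw [Nat.cast_pos, Finset.card_pos]
    exact ⟨0, (hmem j 0).2 (by simp [normSq])⟩
  have hsum : ∀ j, ∑ β ∈ S j, (B.indicator 1 β - d) =
      ∑ β ∈ S j, B.indicator 1 β - d * (S j).card := by
    intro j
    rw [Finset.sum_sub_distrib, Finset.sum_const, nsmul_eq_mul, mul_comm d]
  obtain ⟨J, hJ⟩ := (Metric.tendsto_atTop.1 h1) ε hε
  refine ⟨∑ i ∈ Finset.range J, |∑ β ∈ S i, (B.indicator 1 β - d)|, fun j => ?_⟩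
  have hC : 0 ≤ ∑ i ∈ Finset.range J, |∑ β ∈ S i, (B.indicator (1 : (Fin k → ℤ) → ℝ) β - d)| :=
    Finset.sum_nonneg fun _ _ => abs_nonneg _
  have hN : 0 ≤ ε * (S j).card := mul_nonneg hε.le (hpos j).le
  by_cases hj : j < J
  · have := Finset.single_le_sum
      (f := fun i => |∑ β ∈ S i, (B.indicator (1 : (Fin k → ℤ) → ℝ) β - d)|)
      (fun _ _ => abs_nonneg _) (Finset.mem_range.2 hj)
    linarith
  · have h2 := hJ j (not_lt.1 hj)
    simp only [Function.comp, hcard, hcardB, Real.dist_eq] at h2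
    have h3 : |∑ β ∈ S j, (B.indicator (1 : (Fin k → ℤ) → ℝ) β - d)| ≤ ε * (S j).card := by
      rw [hsum]
      have h4 : ∑ β ∈ S j, B.indicator (1 : (Fin k → ℤ) → ℝ) β - d * (S j).card =
          ((∑ β ∈ S j, B.indicator (1 : (Fin k → ℤ) → ℝ) β) / (S j).card - d) * (S j).card := by
        have := (hpos j).ne'
        field_simp
      rw [h4, abs_mul, abs_of_pos (hpos j)]
      exact mul_le_mul_of_nonneg_right h2.le (hpos j).le
    linarith

/-- A Gaussian gives a set of density `d` the mass `d` in the limit. -/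
theorem tendsto_tsum_indicator_gaussianWeight (hk : 0 < k) {B : Set (Fin k → ℤ)} {d : ℝ}
    (hB : HasAsymptoticDensity B d) :
    Tendsto (fun t => ∑' β, B.indicator (gaussianWeight t) β) (𝓝[>] 0) (𝓝 d) := by
  classical
  have htot := tendsto_tsum_gaussianWeight (k := k)
  have hsqrt : Tendsto (fun t : ℝ => √t ^ k) (𝓝[>] 0) (𝓝 0) := by
    have h : Tendsto (fun t : ℝ => √t ^ k) (𝓝 0) (𝓝 (√0 ^ k)) :=
      ((Real.continuous_sqrt.tendsto 0).pow k)
    rw [Real.sqrt_zero, zero_pow hk.ne'] at h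
    exact h.mono_left nhdsWithin_le_nhds
  -- the constant `C` is multiplied by `√t ^ k`, which tends to `0`
  have key : ∀ t : ℝ, 0 < t → ∀ ε C : ℝ, (∀ j : ℕ,
      |∑ β ∈ (normSq_le_finite (k := k) j).toFinset, (B.indicator 1 β - d)| ≤
      ε * (normSq_le_finite (k := k) j).toFinset.card + C) →
      |∑' β, B.indicator (gaussianWeight t) β - d * ∑' β, gaussianWeight (k := k) t β| ≤
        ε * ∑' β, gaussianWeight (k := k) t β + √t ^ k * C := by
    intro t ht ε C hC
    have hs := (hasSum_gaussianWeight (k := k) ht).summable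
    have hst : 0 < √t ^ k := pow_pos (Real.sqrt_pos.2 ht) k
    have hx1 : Real.exp (-Real.pi * t) < 1 := by
      rw [Real.exp_lt_one_iff]
      have := mul_pos Real.pi_pos ht
      linarith
    have hs' : Summable fun β : Fin k → ℤ => Real.exp (-Real.pi * t) ^ normSq β := by
      rw [show gaussianWeight t = _ from funext (gaussianWeight_eq_pow (k := k) t)] at hs
      exact (summable_mul_left_iff hst.ne').1 hs
    have h1 := abs_tsum_mul_pow_le normSq_le_finite (c := fun β => B.indicator 1 β - d)
      (M := 1 + |d|) (fun β => ?_) (Real.exp_pos _).le hx1 hs' hC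
    · have h2 : ∑' β, B.indicator (gaussianWeight t) β - d * ∑' β, gaussianWeight (k := k) t β =
          √t ^ k * ∑' β, (B.indicator 1 β - d) * Real.exp (-Real.pi * t) ^ normSq β := by
        rw [← tsum_mul_left, ← tsum_mul_left, ← (hs.indicator B).tsum_sub (hs.mul_left d)]
        refine tsum_congr fun β => ?_
        rw [Set.indicator_apply, Set.indicator_apply, gaussianWeight_eq_pow]
        split_ifs
        · simp
          ring
        · ring
      have h3 : ∑' β, gaussianWeight (k := k) t β =
          √t ^ k * ∑' β : Fin k → ℤ, Real.exp (-Real.pi * t) ^ normSq β := by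
        rw [← tsum_mul_left]
        exact tsum_congr fun β => gaussianWeight_eq_pow t β
      rw [h2, h3, abs_mul, abs_of_pos hst]
      calc _ ≤ √t ^ k * (ε * ∑' β : Fin k → ℤ, Real.exp (-Real.pi * t) ^ normSq β + C) :=
            mul_le_mul_of_nonneg_left h1 hst.le
        _ = _ := by ring
    · refine (abs_sub _ _).trans (add_le_add ?_ le_rfl)
      rw [Set.indicator_apply]
      split_ifs <;> simp
  have hdiff : Tendsto (fun t => ∑' β, B.indicator (gaussianWeight t) β -
      d * ∑' β, gaussianWeight (k := k) t β) (𝓝[>] 0) (𝓝 0) := by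
    rw [Metric.tendsto_nhds]
    intro ε hε
    obtain ⟨C, hC⟩ := exists_partial_sum_bound hB (half_pos hε)
    have h1 : Tendsto (fun t => ε / 2 * ∑' β, gaussianWeight (k := k) t β + √t ^ k * C) (𝓝[>] 0)
        (𝓝 (ε / 2 * 1 + 0 * C)) := (htot.const_mul _).add (hsqrt.mul_const C)
    have h2 : ε / 2 * 1 + 0 * C < ε := by linarith
    filter_upwards [h1.eventually_lt_const h2, self_mem_nhdsWithin] with t h3 ht
    rw [Real.dist_eq, sub_zero]
    exact (key t ht _ C hC).trans_lt h3
  have := hdiff.add (htot.const_mul d)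
  simpa using this

end GaussianSums

/-! ### Equidistribution of cyclically reduced words -/

noncomputable section Equidistribution

variable {k : ℕ}

/-- The mean of the normalised numbers of cyclically reduced words of lengths `n` and `n + 1`
with image in `B`. -/
def meanMass (B : Set (Fin k → ℤ)) (n : ℕ) : ℝ :=
  1 / 2 * ((cyclicWords B n).ncard / (2 * k - 1) ^ n +
    (cyclicWords B (n + 1)).ncard / (2 * k - 1) ^ (n + 1))

theorem sum_ncard_cyclicWords_le {B : Set (Fin k → ℤ)} {S : Finset (Fin k → ℤ)}
    (hS : ∀ β ∈ S, β ∈ B) (n : ℕ) :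
    ∑ β ∈ S, (cyclicWords {β} n).ncard ≤ (cyclicWords B n).ncard := by
  classical
  set T : (Fin k → ℤ) → Finset (List (Fin k × Bool)) :=
    fun β => (cyclicWords_finite {β} n).toFinset with hT
  have h1 : ∀ β, (cyclicWords {β} n).ncard = (T β).card :=
    fun β => Set.ncard_eq_toFinset_card _ _
  simp_rw [h1]
  rw [Set.ncard_eq_toFinset_card _ (cyclicWords_finite B n), ← Finset.card_biUnion]
  · refine Finset.card_le_card fun L hL => ?_
    obtain ⟨β, hβ, hL⟩ := Finset.mem_biUnion.1 hL
    simp only [hT, Set.Finite.mem_toFinset] at hL ⊢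
    exact ⟨hL.1, hL.2.1, by rw [show logVector (FreeGroup.mk L) = β from hL.2.2]; exact hS β hβ⟩
  · intro β _ β' _ hne
    rw [Function.onFun, Finset.disjoint_left]
    intro L hL hL'
    simp only [hT, Set.Finite.mem_toFinset] at hL hL'
    exact hne ((show logVector (FreeGroup.mk L) = β from hL.2.2).symm.trans hL'.2.2)

theorem sum_meanDensity_le (hk : 2 ≤ k) {B : Set (Fin k → ℤ)} {S : Finset (Fin k → ℤ)}
    (hS : ∀ β ∈ S, β ∈ B) (n : ℕ) : ∑ β ∈ S, meanDensity n β ≤ meanMass B n := by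
  have hq := card_letters_sub_one_ge hk
  have hle : ∀ m, (∑ β ∈ S, ((cyclicWords {β} m).ncard : ℝ)) ≤ (cyclicWords B m).ncard :=
    fun m => by exact_mod_cast sum_ncard_cyclicWords_le hS m
  simp only [meanDensity, meanMass]
  rw [← Finset.mul_sum, Finset.sum_add_distrib, ← Finset.sum_div, ← Finset.sum_div]
  have h0 : (0 : ℝ) ≤ 2 * k - 1 := by linarith
  gcongr
  · exact hle n
  · exact hle (n + 1)

theorem ncard_cyclicWords_add_compl (B : Set (Fin k → ℤ)) (n : ℕ) :
    (cyclicWords B n).ncard + (cyclicWords Bᶜ n).ncard =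
      (cyclicWords (Set.univ : Set (Fin k → ℤ)) n).ncard := by
  rw [← Set.ncard_union_eq ?_ (cyclicWords_finite B n) (cyclicWords_finite Bᶜ n)]
  · congr 1
    ext L
    simp only [cyclicWords, Set.mem_union, Set.mem_ofPred_eq, Set.mem_compl_iff, Set.mem_univ]
    tauto
  · rw [Set.disjoint_left]
    intro L h1 h2
    exact h2.2.2 h1.2.2

theorem tendsto_ncard_cyclicWords_univ (hk : 2 ≤ k) :
    Tendsto (fun n => ((cyclicWords (Set.univ : Set (Fin k → ℤ)) n).ncard : ℝ) / (2 * k - 1) ^ n)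
      atTop (𝓝 1) := by
  have h1 := (tendsto_charFn hk (u := fun _ => (k : ℝ)) (τ := 0) (by simp) (by simp)).1
  have hq := card_letters_sub_one_ne_zero hk
  rw [← Filter.tendsto_ofReal_iff]
  rw [neg_zero, zero_div, Real.exp_zero] at h1
  refine h1.congr' ?_
  filter_upwards [eventually_gt_atTop 0] with n hn
  have h2 := cyclicWordSum_phase hk hn (0 : Fin k → ℝ)
  have h3 : cyclicWordSum n (phase (0 : Fin k → ℝ)) =
      ((cyclicWords (Set.univ : Set (Fin k → ℤ)) n).ncard : ℂ) := by
    rw [cyclicWordSum, Set.ncard_eq_toFinset_card _ (cyclicWords_finite Set.univ n)]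
    simp [prod_phase]
  rw [h3] at h2
  simp only [Pi.zero_apply, Real.cos_zero, Finset.sum_const, Finset.card_univ, Fintype.card_fin,
    nsmul_eq_mul, mul_one] at h2
  push_cast
  rw [h2, mul_div_cancel_left₀ _ (pow_ne_zero n hq)]

theorem meanMass_add_compl (B : Set (Fin k → ℤ)) (n : ℕ) :
    meanMass B n + meanMass Bᶜ n = meanMass (Set.univ : Set (Fin k → ℤ)) n := by
  have h := fun m => ncard_cyclicWords_add_compl B m
  simp only [meanMass]
  rw [← h n, ← h (n + 1)]
  push_cast
  ring

theorem tendsto_meanMass_univ (hk : 2 ≤ k) :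
    Tendsto (meanMass (Set.univ : Set (Fin k → ℤ))) atTop (𝓝 1) := by
  have h1 := tendsto_ncard_cyclicWords_univ hk
  have h2 := (h1.add (h1.comp (tendsto_add_atTop_nat 1))).const_mul (1 / 2 : ℝ)
  norm_num at h2
  refine h2.congr fun n => ?_
  simp [meanMass]

theorem tendsto_gaussianParam (hk : 2 ≤ k) : Tendsto (gaussianParam k) atTop (𝓝[>] 0) := by
  refine tendsto_nhdsWithin_iff.2 ⟨?_, ?_⟩
  · have h := tendsto_const_div_atTop_nhds_zero_nat ((k - 1 : ℝ) / (2 * Real.pi))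
    refine h.congr fun n => ?_
    rw [gaussianParam, div_div]
  · filter_upwards [eventually_gt_atTop 0] with n hn
    exact gaussianParam_pos hk hn

/-- Outside a ball of radius `√N` the Gaussian weight is dominated by a wider Gaussian. -/
theorem gaussianWeight_le_of_lt {t : ℝ} (ht : 0 < t) {N : ℕ} {β : Fin k → ℤ} (h : N < normSq β) :
    gaussianWeight t β ≤
      √2 ^ k * Real.exp (-(Real.pi * t * N / 2)) * gaussianWeight (t / 2) β := by
  have hpi := Real.pi_pos
  have h1 : √t = √2 * √(t / 2) := by
    rw [← Real.sqrt_mul (by norm_num)]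
    congr 1
    ring
  have h2 : (N : ℝ) ≤ normSq β := by exact_mod_cast h.le
  rw [gaussianWeight, gaussianWeight, ← cast_normSq, h1, mul_pow]
  have h3 : Real.exp (-Real.pi * t * normSq β) ≤
      Real.exp (-(Real.pi * t * N / 2)) * Real.exp (-Real.pi * (t / 2) * normSq β) := by
    rw [← Real.exp_add, Real.exp_le_exp]
    have := mul_le_mul_of_nonneg_left h2 (mul_pos hpi ht).le
    linarith
  calc √2 ^ k * √(t / 2) ^ k * Real.exp (-Real.pi * t * normSq β)
      ≤ √2 ^ k * √(t / 2) ^ k * (Real.exp (-(Real.pi * t * N / 2)) *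
        Real.exp (-Real.pi * (t / 2) * normSq β)) := by gcongr
    _ = _ := by ring

/-- The mass of a set is at least its Gaussian mass, up to the error in the local limit theorem
on a ball and the Gaussian mass outside that ball. -/
theorem tsum_gaussianWeight_sub_le_meanMass (hk : 2 ≤ k) (B : Set (Fin k → ℤ)) {n : ℕ} (hn : 0 < n)
    (N : ℕ) :
    ∑' β, B.indicator (gaussianWeight (gaussianParam k n)) β -
      √2 ^ k * Real.exp (-(Real.pi * gaussianParam k n * N / 2)) *
        ∑' β : Fin k → ℤ, gaussianWeight (gaussianParam k n / 2) β -
      (2 * Nat.sqrt N + 1) ^ k * (((2 * Real.pi) ^ k)⁻¹ * charFnError k n) ≤ meanMass B n := by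
  classical
  set t := gaussianParam k n with htdef
  have ht : 0 < t := gaussianParam_pos hk hn
  set E := ((2 * Real.pi) ^ k)⁻¹ * charFnError k n with hE
  have hE0 : 0 ≤ E := (abs_nonneg _).trans (abs_meanDensity_sub_le hk hn 0)
  set D := √2 ^ k * Real.exp (-(Real.pi * t * N / 2)) with hD
  have hD0 : 0 ≤ D := by positivity
  set F := (normSq_le_finite (k := k) N).toFinset with hF
  set S := F.filter (· ∈ B) with hS
  have hs := (hasSum_gaussianWeight (k := k) ht).summable
  have hs2 := (hasSum_gaussianWeight (k := k) (half_pos ht)).summable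
  have h1 : ∑' β, B.indicator (gaussianWeight t) β ≤
      ∑ β ∈ S, gaussianWeight t β + D * ∑' β : Fin k → ℤ, gaussianWeight (t / 2) β := by
    rw [← tsum_mul_left, ← Finset.tsum_subtype' S, tsum_subtype,
      ← (hs.indicator _).tsum_add (hs2.mul_left D)]
    refine (hs.indicator B).tsum_le_tsum (fun β => ?_) ((hs.indicator _).add (hs2.mul_left D))
    have hw := gaussianWeight_nonneg t β
    have hw2 := mul_nonneg hD0 (gaussianWeight_nonneg (t / 2) β)
    by_cases hβ : β ∈ B
    · by_cases hβF : normSq β ≤ N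
      · rw [Set.indicator_of_mem hβ, Set.indicator_of_mem (by simp [hS, hF, hβ, hβF])]
        linarith
      · rw [Set.indicator_of_mem hβ, Set.indicator_of_notMem (by simp [hS, hF, hβF]), zero_add]
        exact gaussianWeight_le_of_lt ht (not_le.1 hβF)
    · rw [Set.indicator_of_notMem hβ, Set.indicator_of_notMem (by simp [hS, hβ])]
      linarith
  have h2 : ∑ β ∈ S, gaussianWeight t β ≤ ∑ β ∈ S, meanDensity n β + S.card * E := by
    rw [← nsmul_eq_mul, ← Finset.sum_const, ← Finset.sum_add_distrib]
    refine Finset.sum_le_sum fun β _ => ?_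
    have := (abs_le.1 (abs_meanDensity_sub_le hk hn β)).1
    linarith
  have h3 : (S.card : ℝ) ≤ (2 * Nat.sqrt N + 1) ^ k := by
    have : S.card ≤ (2 * Nat.sqrt N + 1) ^ k :=
      (Finset.card_filter_le _ _).trans (card_normSq_le N)
    exact_mod_cast this
  have h4 := sum_meanDensity_le hk (B := B) (S := S) (fun β hβ => (Finset.mem_filter.1 hβ).2) n
  have h5 := mul_le_mul_of_nonneg_right h3 hE0
  linarith

/-- Asymptotically, the mass of every set is bounded below by its Gaussian mass. The bound is
one-sided; it is applied both to a set and to its complement. -/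
theorem eventually_tsum_gaussianWeight_sub_le (hk : 2 ≤ k) (B : Set (Fin k → ℤ)) {ε : ℝ}
    (hε : 0 < ε) : ∀ᶠ n in atTop,
      ∑' β, B.indicator (gaussianWeight (gaussianParam k n)) β - ε ≤ meanMass B n := by
  have hq := card_letters_sub_one_ge hk
  -- the radius is `√(K n)` with `K` large
  obtain ⟨K, hK⟩ : ∃ K : ℕ, √2 ^ k * Real.exp (-((k - 1) * K / 4)) * 2 ≤ ε / 2 := by
    have h1 : Tendsto (fun K : ℕ => √2 ^ k * Real.exp (-((k - 1) * K / 4)) * 2) atTop (𝓝 0) := by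
      have h2 : Tendsto (fun K : ℕ => (k - 1 : ℝ) / 4 * K) atTop atTop :=
        tendsto_natCast_atTop_atTop.const_mul_atTop (by linarith)
      have h3 := ((Real.tendsto_exp_neg_atTop_nhds_zero.comp h2).const_mul (√2 ^ k)).mul_const 2
      simp only [mul_zero, zero_mul] at h3
      refine h3.congr fun K => ?_
      simp only [Function.comp]
      congr 4
      ring
    obtain ⟨K, hK⟩ := (h1.eventually_le_const (half_pos hε)).exists
    exact ⟨K, hK⟩
  have htail : ∀ᶠ n in atTop, ∑' β : Fin k → ℤ, gaussianWeight (gaussianParam k n / 2) β ≤ 2 := by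
    have h1 : Tendsto (fun n => gaussianParam k n / 2) atTop (𝓝[>] 0) := by
      have h2 := tendsto_nhdsWithin_iff.1 (tendsto_gaussianParam hk)
      refine tendsto_nhdsWithin_iff.2 ⟨by simpa using h2.1.div_const 2, ?_⟩
      filter_upwards [h2.2] with n hn
      exact half_pos (Set.mem_Ioi.1 hn)
    exact (tendsto_tsum_gaussianWeight.comp h1).eventually_le_const (by norm_num)
  have herr : Tendsto (fun n : ℕ => (2 * √(K : ℝ) + 1) ^ k * ((2 * Real.pi) ^ k)⁻¹ *
      (√(n : ℝ) ^ k * charFnError k n)) atTop (𝓝 0) := by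
    simpa using (tendsto_charFnError hk).const_mul ((2 * √(K : ℝ) + 1) ^ k * ((2 * Real.pi) ^ k)⁻¹)
  filter_upwards [htail, herr.eventually_le_const (half_pos hε), eventually_gt_atTop 0]
    with n h1 h2 hn
  have hn' : (0 : ℝ) < n := by exact_mod_cast hn
  have hn1 : (1 : ℝ) ≤ n := by exact_mod_cast hn
  refine le_trans ?_ (tsum_gaussianWeight_sub_le_meanMass hk B hn (K * n))
  have h3 : Real.pi * gaussianParam k n * (K * n : ℕ) / 2 = (k - 1) * K / 4 := by
    have := Real.pi_pos
    rw [gaussianParam]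
    push_cast
    field_simp
    ring
  have h4 : (2 * (Nat.sqrt (K * n) : ℝ) + 1) ≤ (2 * √(K : ℝ) + 1) * √(n : ℝ) := by
    have h5 : (Nat.sqrt (K * n) : ℝ) ≤ √(K : ℝ) * √(n : ℝ) := by
      rw [← Real.sqrt_mul (Nat.cast_nonneg K), ← Nat.cast_mul]
      exact Real.nat_sqrt_le_real_sqrt
    have h6 : 1 ≤ √(n : ℝ) := Real.one_le_sqrt.2 hn1
    linarith
  have hE0 : 0 ≤ charFnError k n := MeasureTheory.integral_nonneg fun _ => norm_nonneg _
  have hpi := Real.pi_pos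
  have h7 : (2 * (Nat.sqrt (K * n) : ℝ) + 1) ^ k * (((2 * Real.pi) ^ k)⁻¹ * charFnError k n) ≤
      ε / 2 := by
    refine le_trans ?_ h2
    calc _ ≤ ((2 * √(K : ℝ) + 1) * √(n : ℝ)) ^ k * (((2 * Real.pi) ^ k)⁻¹ * charFnError k n) := by
          gcongr
      _ = _ := by rw [mul_pow]; ring
  have h8 : √2 ^ k * Real.exp (-(Real.pi * gaussianParam k n * (K * n : ℕ) / 2)) *
        ∑' β : Fin k → ℤ, gaussianWeight (gaussianParam k n / 2) β ≤ ε / 2 := by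
    refine le_trans ?_ hK
    rw [h3]
    gcongr
  linarith

/-- Cyclically reduced words, averaged over two consecutive lengths, are equidistributed with
respect to asymptotic density. -/
theorem tendsto_meanMass (hk : 2 ≤ k) {B : Set (Fin k → ℤ)} {d : ℝ}
    (hB : HasAsymptoticDensity B d) : Tendsto (meanMass B) atTop (𝓝 d) := by
  have ht := tendsto_gaussianParam hk
  have h1 := (tendsto_tsum_indicator_gaussianWeight (by omega) hB).comp ht
  have h2 := (tendsto_tsum_gaussianWeight (k := k)).comp ht
  have h3 : Tendsto (fun n => ∑' β, Bᶜ.indicator (gaussianWeight (gaussianParam k n)) β) atTop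
      (𝓝 (1 - d)) := by
    refine (h2.sub h1).congr' ?_
    filter_upwards [eventually_gt_atTop 0] with n hn
    have hs := (hasSum_gaussianWeight (k := k) (gaussianParam_pos hk hn)).summable
    simp only [Function.comp]
    rw [← hs.tsum_sub (hs.indicator B)]
    refine tsum_congr fun β => ?_
    rw [Set.indicator_compl, Pi.sub_apply]
  rw [Metric.tendsto_nhds]
  intro ε hε
  have hε4 : 0 < ε / 4 := by linarith
  filter_upwards [eventually_tsum_gaussianWeight_sub_le hk B hε4,
    eventually_tsum_gaussianWeight_sub_le hk Bᶜ hε4,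
    h1.eventually_const_lt (show d - ε / 4 < d by linarith),
    h3.eventually_const_lt (show 1 - d - ε / 4 < 1 - d by linarith),
    (tendsto_meanMass_univ hk).eventually_lt_const (show 1 < 1 + ε / 4 by linarith)]
    with n a1 a2 a3 a4 a5
  -- the lower bound for `Bᶜ` is an upper bound for `B`, as the total mass tends to `1`
  have a6 := meanMass_add_compl B n
  simp only [Function.comp] at a3
  rw [Real.dist_eq, abs_lt]
  constructor <;> linarith

end Equidistribution

/-! ### From cyclically reduced words to conjugacy classes -/

noncomputable section ClassCounts

variable {k : ℕ}

theorem setOf_classLength_le_finite (B : Set (Fin k → ℤ)) (m : ℕ) :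
    {c : ConjClasses (FreeGroup (Fin k)) | classLength c ≤ m ∧ classLogVector c ∈ B}.Finite := by
  refine ((Set.finite_Iic m).biUnion fun n _ => classesOfLength_finite B n).subset ?_
  rintro c ⟨h1, h2⟩
  exact Set.mem_biUnion (Set.mem_Iic.2 h1) ⟨rfl, h2⟩

theorem classCountIn_succ (B : Set (Fin k → ℤ)) (m : ℕ) :
    classCountIn B (m + 1) = classCountIn B m + (classesOfLength B (m + 1)).ncard := by
  rw [classCountIn, classCountIn, ← Set.ncard_union_eq ?_ (setOf_classLength_le_finite B m)
    (classesOfLength_finite B (m + 1))]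
  · congr 1
    ext c
    simp only [classesOfLength, Set.mem_union, Set.mem_ofPred_eq, Nat.le_succ_iff]
    tauto
  · rw [Set.disjoint_left]
    rintro c ⟨h1, -⟩ ⟨h2, -⟩
    omega

theorem classCount_eq (k m : ℕ) : classCount k m = classCountIn (Set.univ : Set (Fin k → ℤ)) m := by
  simp [classCount, classCountIn]

theorem classCountIn_le_classCount (B : Set (Fin k → ℤ)) (m : ℕ) :
    classCountIn B m ≤ classCount k m := by
  rw [classCount_eq]
  exact Set.ncard_le_ncard (fun c hc => ⟨hc.1, Set.mem_univ _⟩) (setOf_classLength_le_finite _ m)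

/-- The solution of a contracting affine recursion converges. -/
theorem tendsto_of_affine_recursion {x w : ℕ → ℝ} {ρ l : ℝ} (hρ0 : 0 ≤ ρ) (hρ1 : ρ < 1)
    (hw : Tendsto w atTop (𝓝 l)) (hx : ∀ m, x (m + 1) = ρ * x m + w m) :
    Tendsto x atTop (𝓝 (l / (1 - ρ))) := by
  have hρ : 0 < 1 - ρ := by linarith
  set L := l / (1 - ρ) with hL
  have hLl : L = ρ * L + l := by
    rw [hL]
    field_simp
    ring
  rw [Metric.tendsto_atTop]
  intro ε hε
  obtain ⟨M, hM⟩ := Metric.tendsto_atTop.1 hw (ε / 2 * (1 - ρ)) (by positivity)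
  have h1 : ∀ j, |x (M + j) - L| ≤ ρ ^ j * |x M - L| + ε / 2 := by
    intro j
    induction j with
    | zero =>
      simp
      linarith
    | succ j ih =>
      have h2 := hM (M + j) (by omega)
      rw [Real.dist_eq] at h2
      have h3 : x (M + (j + 1)) - L = ρ * (x (M + j) - L) + (w (M + j) - l) := by
        rw [← add_assoc, hx]
        linear_combination -hLl
      rw [h3]
      calc _ ≤ |ρ * (x (M + j) - L)| + |w (M + j) - l| := abs_add_le _ _
        _ ≤ ρ * (ρ ^ j * |x M - L| + ε / 2) + ε / 2 * (1 - ρ) := by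
            rw [abs_mul, abs_of_nonneg hρ0]
            gcongr
        _ = _ := by ring
  have h4 : Tendsto (fun j => ρ ^ j * |x M - L|) atTop (𝓝 0) := by
    simpa using (tendsto_pow_atTop_nhds_zero_of_lt_one hρ0 hρ1).mul_const |x M - L|
  obtain ⟨J, hJ⟩ := eventually_atTop.1 (h4.eventually_lt_const (half_pos hε))
  refine ⟨M + J, fun m hm => ?_⟩
  obtain ⟨j, rfl⟩ := Nat.exists_eq_add_of_le (show M ≤ m by omega)
  have := h1 j
  have := hJ j (by omega)
  rw [Real.dist_eq]
  linarith

/-- The number of classes of length `n` with image in `B`, normalised to be of order one. -/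
def classDensity (B : Set (Fin k → ℤ)) (n : ℕ) : ℝ :=
  n * (classesOfLength B n).ncard / (2 * k - 1) ^ n

/-- There are few words with a period at most `n / 2`, since `√(2k) < 2k - 1`. -/
theorem tendsto_nonprimitive_bound (hk : 2 ≤ k) :
    Tendsto (fun n : ℕ => (n * (n * (2 * k : ℝ) ^ (n / 2))) / (2 * k - 1) ^ n) atTop (𝓝 0) := by
  have hq := card_letters_sub_one_ge hk
  set r : ℝ := √(2 * k) / (2 * k - 1) with hr
  have hr0 : 0 ≤ r := by positivity
  have hr1 : r < 1 := by
    rw [hr, div_lt_one (by linarith), Real.sqrt_lt' (by linarith)]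
    nlinarith
  have h1 := tendsto_pow_const_mul_const_pow_of_lt_one 2 hr0 hr1
  refine squeeze_zero (fun n => by positivity) (fun n => ?_) h1
  have h2 : (2 * k : ℝ) ^ (n / 2) ≤ √(2 * k) ^ n := by
    have h3 : (1 : ℝ) ≤ √(2 * k) := Real.one_le_sqrt.2 (by linarith)
    calc (2 * k : ℝ) ^ (n / 2) = (√(2 * k) ^ 2) ^ (n / 2) := by
          rw [Real.sq_sqrt (by linarith)]
      _ = √(2 * k) ^ (2 * (n / 2)) := by rw [pow_mul]
      _ ≤ _ := pow_le_pow_right₀ h3 (by omega)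
  have h0 : (0 : ℝ) < (2 * k - 1) ^ n := pow_pos (by linarith) n
  rw [hr, div_pow, ← mul_div_assoc]
  refine div_le_div_of_nonneg_right ?_ h0.le
  calc (n : ℝ) * (n * (2 * k : ℝ) ^ (n / 2)) ≤ n * (n * √(2 * k) ^ n) := by gcongr
    _ = _ := by ring

/-- Conjugacy classes of length `n`, counted `n` times, and cyclically reduced words of length `n`
are asymptotically equally numerous. -/
theorem tendsto_classDensity_sub (hk : 2 ≤ k) (B : Set (Fin k → ℤ)) :
    Tendsto (fun n => classDensity B n - (cyclicWords B n).ncard / (2 * k - 1) ^ n)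
      atTop (𝓝 0) := by
  have hq := card_letters_sub_one_ge hk
  refine squeeze_zero_norm' ?_ (tendsto_nonprimitive_bound hk)
  filter_upwards [eventually_gt_atTop 0] with n hn
  obtain ⟨h1, h2⟩ := ncard_classesOfLength_bounds B hn (by omega)
  have h1' : ((cyclicWords B n).ncard : ℝ) ≤ n * (classesOfLength B n).ncard := by exact_mod_cast h1
  have h2' : (n * (classesOfLength B n).ncard : ℝ) ≤
      (cyclicWords B n).ncard + n * (n * (2 * k) ^ (n / 2)) := by exact_mod_cast h2
  have h0 : (0 : ℝ) < (2 * k - 1) ^ n := pow_pos (by linarith) n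
  rw [classDensity, ← sub_div, Real.norm_eq_abs, abs_of_nonneg (div_nonneg (by linarith) h0.le)]
  refine div_le_div_of_nonneg_right ?_ h0.le
  linarith

theorem tendsto_classDensity_univ (hk : 2 ≤ k) :
    Tendsto (classDensity (Set.univ : Set (Fin k → ℤ))) atTop (𝓝 1) := by
  simpa using (tendsto_classDensity_sub hk Set.univ).add (tendsto_ncard_cyclicWords_univ hk)

theorem tendsto_classDensity_add_succ (hk : 2 ≤ k) {B : Set (Fin k → ℤ)} {d : ℝ}
    (hB : HasAsymptoticDensity B d) :
    Tendsto (fun n => classDensity B n + classDensity B (n + 1)) atTop (𝓝 (2 * d)) := by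
  have h1 := tendsto_classDensity_sub hk B
  have h2 := h1.comp (tendsto_add_atTop_nat 1)
  have h3 := (tendsto_meanMass hk hB).const_mul 2
  have h4 := (h1.add h2).add h3
  simp only [zero_add] at h4
  refine h4.congr fun n => ?_
  simp only [Function.comp, meanMass]
  ring

/-- The normalised count `Π_B(m) / q ^ m`, where `q = 2k - 1`. -/
def countRatio (B : Set (Fin k → ℤ)) (m : ℕ) : ℝ := classCountIn B m / (2 * k - 1) ^ m

theorem countRatio_nonneg (hk : 2 ≤ k) (B : Set (Fin k → ℤ)) (m : ℕ) : 0 ≤ countRatio B m := by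
  have hq := card_letters_sub_one_ge hk
  have h0 : (0 : ℝ) < (2 * k - 1) ^ m := pow_pos (by linarith) m
  unfold countRatio
  positivity

theorem countRatio_le_univ (hk : 2 ≤ k) (B : Set (Fin k → ℤ)) (m : ℕ) :
    countRatio B m ≤ countRatio (Set.univ : Set (Fin k → ℤ)) m := by
  have hq := card_letters_sub_one_ge hk
  have h0 : (0 : ℝ) < (2 * k - 1) ^ m := pow_pos (by linarith) m
  have := classCountIn_le_classCount B m
  rw [classCount_eq] at this
  unfold countRatio
  gcongr

theorem countRatio_succ (hk : 2 ≤ k) (B : Set (Fin k → ℤ)) (m : ℕ) :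
    countRatio B (m + 1) =
      (2 * k - 1 : ℝ)⁻¹ * countRatio B m + classDensity B (m + 1) / (m + 1 : ℕ) := by
  have hq := card_letters_sub_one_ge hk
  have h0 : (2 * k - 1 : ℝ) ≠ 0 := by linarith
  have h1 : ((m + 1 : ℕ) : ℝ) ≠ 0 := by positivity
  rw [countRatio, countRatio, classDensity, classCountIn_succ, pow_succ]
  push_cast at h1 ⊢
  field_simp

/-- The recursion for `m Π_B(m) / q ^ m`. Its inhomogeneous term converges, whence so does the
sequence by `tendsto_of_affine_recursion`. -/
theorem mul_countRatio_succ (hk : 2 ≤ k) (B : Set (Fin k → ℤ)) (m : ℕ) :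
    ((m + 1 : ℕ) : ℝ) * countRatio B (m + 1) = (2 * k - 1 : ℝ)⁻¹ * (m * countRatio B m) +
      ((2 * k - 1 : ℝ)⁻¹ * countRatio B m + classDensity B (m + 1)) := by
  have h1 : ((m + 1 : ℕ) : ℝ) ≠ 0 := by positivity
  rw [countRatio_succ hk, mul_add, mul_div_cancel₀ _ h1]
  push_cast
  ring

theorem tendsto_countRatio (hk : 2 ≤ k) (B : Set (Fin k → ℤ)) :
    Tendsto (countRatio B) atTop (𝓝 0) := by
  have hq := card_letters_sub_one_ge hk
  have h1 : Tendsto (fun m : ℕ => classDensity (Set.univ : Set (Fin k → ℤ)) (m + 1) / (m + 1 : ℕ))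
      atTop (𝓝 0) :=
    ((tendsto_classDensity_univ hk).div_atTop tendsto_natCast_atTop_atTop).comp
      (tendsto_add_atTop_nat 1)
  have h2 := tendsto_of_affine_recursion (inv_nonneg.2 (by linarith))
    (inv_lt_one_of_one_lt₀ (by linarith)) h1 (countRatio_succ hk Set.univ)
  rw [zero_div] at h2
  exact squeeze_zero (countRatio_nonneg hk B) (countRatio_le_univ hk B) h2

theorem tendsto_mul_countRatio_univ (hk : 2 ≤ k) :
    Tendsto (fun m : ℕ => m * countRatio (Set.univ : Set (Fin k → ℤ)) m) atTop
      (𝓝 (1 / (1 - (2 * k - 1 : ℝ)⁻¹))) := by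
  have hq := card_letters_sub_one_ge hk
  refine tendsto_of_affine_recursion (inv_nonneg.2 (by linarith))
    (inv_lt_one_of_one_lt₀ (by linarith)) ?_ (mul_countRatio_succ hk Set.univ)
  have h1 := ((tendsto_countRatio hk (Set.univ : Set (Fin k → ℤ))).const_mul
    (2 * k - 1 : ℝ)⁻¹).add ((tendsto_classDensity_univ hk).comp (tendsto_add_atTop_nat 1))
  simpa using h1

theorem tendsto_mul_countRatio_add_succ (hk : 2 ≤ k) {B : Set (Fin k → ℤ)} {d : ℝ}
    (hB : HasAsymptoticDensity B d) :
    Tendsto (fun m : ℕ => m * countRatio B m + (m + 1 : ℕ) * countRatio B (m + 1)) atTop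
      (𝓝 (2 * d / (1 - (2 * k - 1 : ℝ)⁻¹))) := by
  have hq := card_letters_sub_one_ge hk
  have h1 := (tendsto_countRatio hk B).const_mul (2 * k - 1 : ℝ)⁻¹
  have h2 := h1.comp (tendsto_add_atTop_nat 1)
  have h3 := (tendsto_classDensity_add_succ hk hB).comp (tendsto_add_atTop_nat 1)
  have h4 := (h1.add h2).add h3
  simp only [mul_zero, zero_add] at h4
  refine tendsto_of_affine_recursion (inv_nonneg.2 (by linarith))
    (inv_lt_one_of_one_lt₀ (by linarith)) h4 fun m => ?_
  rw [mul_countRatio_succ hk B (m + 1)]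
  nth_rewrite 1 [mul_countRatio_succ hk B m]
  simp only [Function.comp]
  ring

end ClassCounts

theorem theorem1p2 (k : ℕ) (hk : 2 ≤ k) (B : Set (Fin k → ℤ)) (d : ℝ)
    (hB : HasAsymptoticDensity B d) :
    Tendsto
      (fun m : ℕ => (1 / 2 : ℝ) *
        ((classCountIn B m : ℝ) / (classCount k m : ℝ) +
          (classCountIn B (m + 1) : ℝ) / (classCount k (m + 1) : ℝ)))
      atTop (𝓝 d) := by
  have hq := card_letters_sub_one_ge hk
  set L : ℝ := 1 / (1 - (2 * k - 1 : ℝ)⁻¹) with hL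
  have hL0 : 0 < L := by
    have : (2 * k - 1 : ℝ)⁻¹ < 1 := inv_lt_one_of_one_lt₀ (by linarith)
    exact one_div_pos.2 (by linarith)
  set a : ℕ → ℝ := fun m => m * countRatio (Set.univ : Set (Fin k → ℤ)) m with ha
  set b : ℕ → ℝ := fun m => m * countRatio B m with hb
  have ha_lim : Tendsto a atTop (𝓝 L) := tendsto_mul_countRatio_univ hk
  have hab : ∀ m, |b m| ≤ a m := by
    intro m
    rw [abs_of_nonneg (mul_nonneg (Nat.cast_nonneg m) (countRatio_nonneg hk B m))]
    exact mul_le_mul_of_nonneg_left (countRatio_le_univ hk B m) (Nat.cast_nonneg m)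
  -- replacing the denominators by their limit changes the quotients by a null sequence
  have herr : Tendsto (fun m => b m * ((a m)⁻¹ - L⁻¹)) atTop (𝓝 0) := by
    have h1 : Tendsto (fun m => a m * |(a m)⁻¹ - L⁻¹|) atTop (𝓝 0) := by
      have h2 := ha_lim.mul (((ha_lim.inv₀ hL0.ne').sub_const L⁻¹).abs)
      simpa using h2
    refine squeeze_zero_norm (fun m => ?_) h1
    rw [Real.norm_eq_abs, abs_mul]
    exact mul_le_mul_of_nonneg_right (hab m) (abs_nonneg _)
  have hsum := (tendsto_mul_countRatio_add_succ hk hB).mul_const L⁻¹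
  have h3 := ((herr.add (herr.comp (tendsto_add_atTop_nat 1))).add hsum).const_mul (1 / 2 : ℝ)
  have h4 : 1 / 2 * (0 + 0 + 2 * d / (1 - (2 * k - 1 : ℝ)⁻¹) * L⁻¹) = d := by
    have h5 : 2 * d / (1 - (2 * k - 1 : ℝ)⁻¹) = 2 * d * L := by rw [hL]; ring
    rw [h5, mul_assoc, mul_inv_cancel₀ hL0.ne']
    ring
  rw [h4] at h3
  have hratio : ∀ m : ℕ, 0 < m →
      (classCountIn B m : ℝ) / (classCount k m : ℝ) = b m * (a m)⁻¹ := by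
    intro m hm
    have hm' : (m : ℝ) ≠ 0 := by positivity
    have hqm : ((2 * k - 1 : ℝ) ^ m) ≠ 0 := pow_ne_zero m (by linarith)
    simp only [ha, hb, countRatio]
    rw [← div_eq_mul_inv, mul_div_mul_left _ _ hm', div_div_div_cancel_right₀ hqm, classCount_eq]
  refine h3.congr' ?_
  filter_upwards [eventually_gt_atTop 0] with m hm
  rw [hratio m hm, hratio (m + 1) (by omega)]
  simp only [Function.comp, ha, hb]
  ring
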